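/- **Setting.** Let $(\Omega,\mathcal F,(\mathcal F_t)_{t\ge0},\mathbb P)$ be a filtered probability space with $\mathcal F_0$ $\mathbb P$-trivial, let $P^0$ be a càdlàg $(\mathcal F_t)$-martingale, $\gamma>0$, and $h(x)=\eta x$ with $\eta>0$ (an Almgren--Chriss model with linear temporary impact). Let $0<\tau_1<\tau_2<\cdots$ be the arrival times of potentially matching dark-pool orders and $\widetilde Y_1,\widetilde Y_2,\ldots\in(0,\infty]$ their sizes. Assume that $N_t=\max\{k:\tau_k\le t\}$ (with $N_t=0$ if $\tau_1>t$) is a Poisson process with parameter $\theta>0$, that the $\widetilde Y_i$ are i.i.d. with $\mathbb P[\widetilde Y_1\ge x]>0$ for all real $x>0$, and that $\bigvee_t\mathcal F_t$, $(\tau_i)_{i\ge1}$ and $(\widetilde Y_i)_{i\ge1}$ are independent. For a dark-pool order $\widehat X\in\mathbb R$ with minimum quantity level $\Xi\in[0,|\widehat X|]$, let $$Y_i=\operatorname{sgn}(\widehat X)\,\min\Big\{\widetilde Y_i,\ |\widehat X|-\sum_{j<i}|Y_j|\Big\}\ \text{ if }\widetilde Y_i\ge\Xi,\qquad Y_i=0\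 \text{ otherwise},\qquad Z_t=\sum_{i=1}^{N_t}Y_i ,$$ and let $(\mathcal G_t)$ be the right-continuous filtration generated by $(\mathcal F_t)$, $Z$ and $(\tau_i\wedge t)_{t\ge0}$, $i\ge1$. For $X_0\in\mathbb R$ and $T>0$, an admissible strategy $\chi\in\mathcal X(X_0,T)$ is a quadruple $(\widehat X,\Xi,\xi,\rho)$ with $\widehat X,\Xi$ as above, a $(\mathcal G_t)$-stopping time $\rho$ with $\rho<T$ a.s., and a $(\mathcal G_t)$-predictable process $\xi$ that is a.s. integrable on $[0,T]$, whose integral $\int_0^t\xi_s\,ds$ is bounded uniformly in $t\in[0,T]$ and (almost all) $\omega$, such that $X_0+\int_0^T\xi_t\,dt+Z_\rho=0$ a.s. With the parameters $\alpha=0$ (no virtual cross-impact), $\beta=0$ (no slippage) and $\kappa=0$ (no temporary cross-impact), its costs are $$\mathcal C_T^\chi=X_0P^0_0+\int_0^T\xi_t\Big(P^0_t+\gamma\int_0^t\xi_s\,ds+\eta\,\xi_t\Big)dt+\sum_{i=1}^{N_\rho}Y_i\Big(P^0_{\tau_i}+\gamma\int_0^{\tau_i}\xi_s\,ds\Big)\in(-\infty,\infty]\quad\text{a.s.}$$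 **Proposition.** Let $X_0\in\mathbb R$, $T>0$ and $\chi=(\widehat X,\Xi,\xi,\rho)\in\mathcal X(X_0,T)$. 1. If $X_0\ge0$ and a.s. $\xi_t\le0$ for all $t\in[0,T]$, or if $X_0\le0$ and a.s. $\xi_t\ge0$ for all $t\in[0,T]$, then $\mathbb E[\mathcal C^\chi_T]$ exists in $(-\infty,\infty]$ and $\mathbb E[\mathcal C_T^\chi]\ge0$. 2. Consequently, negative expected costs require intermediate trades at the exchange in the opposite direction: if $\mathbb E[\mathcal C_T^\chi]<0$, then it is not the case that a.s. $\xi_t\le0$ for all $t\in[0,T]$ when $X_0\ge0$ (intermediate buying), and it is not the case that a.s. $\xi_t\ge0$ for all $t\in[0,T]$ when $X_0\le0$ (intermediate selling). -/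

import Mathlib

open MeasureTheory ProbabilityTheory Filter Topology Set
open scoped NNReal ENNReal

noncomputable section

/-- An impact function: continuous, strictly increasing, vanishing at `0`, and such that
`x ↦ x h(x)` is convex. -/
structure IsImpactFunction (h : ℝ → ℝ) : Prop where
  continuous : Continuous h
  strictMono : StrictMono h
  map_zero : h 0 = 0
  convex : ConvexOn ℝ univ (fun x => x * h x)

/-- Right-continuous with (finite) left limits. -/
def IsCadlagPath (x : ℝ≥0 → ℝ) : Prop :=
  ∀ t, ContinuousWithinAt x (Ici t) t ∧ ∃ l, Tendsto x (𝓝[<] t) (𝓝 l)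

/-- `N` is a standard Poisson process with parameter `θ` under `P`: it starts at `0` and has
independent increments with `N_t - N_s` Poisson distributed with parameter `θ (t - s)`. -/
structure IsPoissonProcess {Ω : Type*} [MeasurableSpace Ω] (N : ℝ≥0 → Ω → ℕ) (θ : ℝ≥0)
    (P : Measure Ω) : Prop where
  zero : ∀ᵐ ω ∂P, N 0 ω = 0
  indep : HasIndepIncrements (fun t ω => (N t ω : ℝ)) P
  law : ∀ s t : ℝ≥0, s ≤ t →
    P.map (fun ω => (N t ω : ℝ) - (N s ω : ℝ)) =
      (poissonMeasure (θ * (t - s))).map (Nat.cast : ℕ → ℝ)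

/-- The quasi-integral `∫ f⁺ - ∫ f⁻` with values in `[-∞, ∞]`. If both parts are infinite, the
integral does not exist and the value is `⊥` (since `⊤ - ⊤ = ⊥` in `EReal`). In particular
`0 ≤ quasiIntegral μ f` contains the assertion that the negative part has a finite integral. -/
def quasiIntegral {α : Type*} [MeasurableSpace α] (μ : Measure α) (f : α → EReal) : EReal :=
  ((∫⁻ x, (f x).toENNReal ∂μ : ℝ≥0∞) : EReal) - ((∫⁻ x, (-f x).toENNReal ∂μ : ℝ≥0∞) : EReal)

/-- The data of an Almgren--Chriss model `(γ, h, P⁰)` on a filtered measurable space together with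
its dark-pool extension `(α, β, κ, (τ_i), (Ỹ_i))`. The sequences are indexed from `0`: `τ i` and
`Yt i` are the time and the size of the `(i+1)`-st incoming matching order. -/
structure DarkPoolModel (Ω : Type*) [mΩ : MeasurableSpace Ω] where
  F : Filtration ℝ≥0 mΩ
  γ : ℝ
  h : ℝ → ℝ
  P0 : ℝ≥0 → Ω → ℝ
  α : ℝ
  β : ℝ → ℝ
  κ : ℝ
  τ : ℕ → Ω → ℝ≥0
  Yt : ℕ → Ω → ℝ≥0∞
  measurable_τ : ∀ i, Measurable (τ i)
  measurable_Yt : ∀ i, Measurable (Yt i)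

/-- A strategy `(X̂, Ξ, ξ, ρ)`: dark-pool order, minimum quantity level, trading speed at the
exchange, cancellation time. -/
structure DarkPoolStrategy (Ω : Type*) where
  Xhat : ℝ
  Ξ : ℝ
  ξ : ℝ≥0 → Ω → ℝ
  ρ : Ω → ℝ≥0

namespace DarkPoolStrategy

variable {Ω : Type*} (χ : DarkPoolStrategy Ω)

/-- `∫_0^t ξ_s ds`, the number of shares bought at the exchange up to time `t`. -/
def traded (t : ℝ≥0) (ω : Ω) : ℝ := ∫ s in (0 : ℝ)..t, χ.ξ s.toNNReal ω

end DarkPoolStrategy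

namespace DarkPoolModel

variable {Ω : Type*} [mΩ : MeasurableSpace Ω] (m : DarkPoolModel Ω)

/-- The conditions on an Almgren--Chriss model. -/
structure IsAlmgrenChriss (P : Measure Ω) : Prop where
  γ_pos : 0 < m.γ
  impact : IsImpactFunction m.h
  martingale : Martingale m.P0 m.F P
  cadlag : ∀ᵐ ω ∂P, IsCadlagPath (fun t => m.P0 t ω)
  trivial_zero : ∀ A, MeasurableSet[m.F 0] A → P A = 0 ∨ P A = 1

/-- `N_t = max {k | τ_k ≤ t}` (`k = 1, 2, …`, and `0` if there is no such `k`). -/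
def N (t : ℝ≥0) (ω : Ω) : ℕ := sSup {k : ℕ | ∃ i, k = i + 1 ∧ m.τ i ω ≤ t}

/-- The size of the part of the `(i+1)`-st incoming order that is matched with an order of size
`|X̂|` of which the volume `v` has been filled before: nothing if the incoming order is below the
minimum quantity level, else the incoming order or the remainder, whichever is smaller. -/
def matched (Xhat Ξ : ℝ) (i : ℕ) (v : ℝ) (ω : Ω) : ℝ :=
  if ENNReal.ofReal Ξ ≤ m.Yt i ω then (min (m.Yt i ω) (ENNReal.ofReal (|Xhat| - v))).toReal else 0

/-- The volume (in absolute terms) filled by the first `i` incoming orders. -/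
def filled (Xhat Ξ : ℝ) : ℕ → Ω → ℝ
  | 0, _ => 0
  | i + 1, ω => filled Xhat Ξ i ω + m.matched Xhat Ξ i (filled Xhat Ξ i ω) ω

/-- The signed part of the `(i+1)`-st incoming order that is executed against the order `X̂`. -/
def Y (Xhat Ξ : ℝ) (i : ℕ) (ω : Ω) : ℝ :=
  Real.sign Xhat * m.matched Xhat Ξ i (m.filled Xhat Ξ i ω) ω

/-- `Z_t`, the number of shares executed in the dark pool until time `t` (without cancellation). -/
def Z (Xhat Ξ : ℝ) (t : ℝ≥0) (ω : Ω) : ℝ := ∑ i ∈ Finset.range (m.N t ω), m.Y Xhat Ξ i ω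

lemma measurable_N (t : ℝ≥0) : Measurable (m.N t) := by
  have hpos : ∀ n : ℕ, MeasurableSet (m.N t ⁻¹' {n + 1}) := by
    intro n
    have : m.N t ⁻¹' {n + 1} =
        {ω | m.τ n ω ≤ t} ∩ ⋂ j : ℕ, {ω | m.τ j ω ≤ t → j ≤ n} := by
      ext ω
      simp only [mem_preimage, mem_singleton_iff, mem_inter_iff, mem_ofPred_eq, mem_iInter]
      constructor
      · intro hN
        have hb : BddAbove {k : ℕ | ∃ i, k = i + 1 ∧ m.τ i ω ≤ t} := by
          by_contra hb
          rw [N, Nat.sSup_of_not_bddAbove hb] at hN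
          omega
        have hne : {k : ℕ | ∃ i, k = i + 1 ∧ m.τ i ω ≤ t}.Nonempty := by
          by_contra hne
          rw [not_nonempty_iff_eq_empty] at hne
          rw [N, hne] at hN
          simp at hN
        have hmem := Nat.sSup_mem hne hb
        rw [N] at hN
        rw [hN] at hmem
        obtain ⟨i, hi, hle⟩ := hmem
        obtain rfl : n = i := by omega
        refine ⟨hle, fun j hj => ?_⟩
        have := le_csSup hb ⟨j, rfl, hj⟩
        omega
      · rintro ⟨h1, h2⟩
        refine IsGreatest.csSup_eq ⟨⟨n, rfl, h1⟩, ?_⟩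
        rintro k ⟨i, rfl, hi⟩
        have := h2 i hi
        omega
    rw [this]
    refine (measurableSet_le (m.measurable_τ n) measurable_const).inter
      (MeasurableSet.iInter fun j => ?_)
    by_cases hj : j ≤ n
    · simp [hj]
    · simpa [hj] using measurableSet_lt measurable_const (m.measurable_τ j)
  refine measurable_to_countable' fun n => ?_
  cases n with
  | succ n => exact hpos n
  | zero =>
    have : m.N t ⁻¹' {0} = (⋃ n : ℕ, m.N t ⁻¹' {n + 1})ᶜ := by
      ext ω
      simp only [mem_preimage, mem_singleton_iff, mem_compl_iff, mem_iUnion, not_exists]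
      constructor
      · intro h n
        omega
      · intro h
        by_contra h0
        exact h (m.N t ω - 1) (by omega)
    rw [this]
    exact (MeasurableSet.iUnion hpos).compl

lemma measurable_matched (Xhat Ξ : ℝ) (i : ℕ) {v : Ω → ℝ} (hv : Measurable v) :
    Measurable (fun ω => m.matched Xhat Ξ i (v ω) ω) := by
  unfold matched
  refine Measurable.ite (measurableSet_le measurable_const (m.measurable_Yt i)) ?_
    measurable_const
  exact ((m.measurable_Yt i).min (measurable_const.sub hv).ennreal_ofReal).ennreal_toReal

lemma measurable_filled (Xhat Ξ : ℝ) (i : ℕ) : Measurable (m.filled Xhat Ξ i) := by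
  induction i with
  | zero => exact measurable_const
  | succ i ih => exact ih.add (m.measurable_matched Xhat Ξ i ih)

lemma measurable_Y (Xhat Ξ : ℝ) (i : ℕ) : Measurable (m.Y Xhat Ξ i) :=
  (m.measurable_matched Xhat Ξ i (m.measurable_filled Xhat Ξ i)).const_mul _

lemma measurable_Z (Xhat Ξ : ℝ) (t : ℝ≥0) : Measurable (m.Z Xhat Ξ t) := by
  have h : Measurable (fun p : ℕ × Ω => ∑ i ∈ Finset.range p.1, m.Y Xhat Ξ i p.2) :=
    measurable_from_prod_countable_right fun n =>
      Finset.measurable_sum (Finset.range n) fun i _ => m.measurable_Y Xhat Ξ i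
  exact h.comp ((m.measurable_N t).prodMk measurable_id)

/-- `(𝒢_t)`, the right-continuous filtration generated by `(ℱ_t)`, `Z` and all `(τ_i ∧ t)`. -/
def G (Xhat Ξ : ℝ) : Filtration ℝ≥0 mΩ :=
  (m.F ⊔ Filtration.natural (m.Z Xhat Ξ) (fun t => (m.measurable_Z Xhat Ξ t).stronglyMeasurable) ⊔
    ⨆ i, Filtration.natural (fun t ω => min (m.τ i ω) t)
      (fun _ => ((m.measurable_τ i).min measurable_const).stronglyMeasurable)).rightCont

/-- The conditions on the incoming orders and on the parameters `α`, `β`, `κ` under which the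
special model characteristics are studied: zero slippage, Poisson arrivals, i.i.d. positive
(possibly infinite) order sizes with unbounded law, and independence of the exchange `(ℱ_t)`,
the arrival times and the order sizes. -/
structure HasPoissonOrders (P : Measure Ω) (θ : ℝ≥0) : Prop where
  α_mem : m.α ∈ Icc (0 : ℝ) 1
  κ_nonneg : 0 ≤ m.κ
  β_zero : ∀ y, m.β y = 0
  τ_increasing : ∀ᵐ ω ∂P, 0 < m.τ 0 ω ∧ StrictMono (fun i => m.τ i ω)
  poisson : IsPoissonProcess m.N θ P
  Yt_pos : ∀ i, ∀ᵐ ω ∂P, 0 < m.Yt i ω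
  Yt_indep : iIndepFun m.Yt P
  Yt_identDistrib : ∀ i, IdentDistrib (m.Yt i) (m.Yt 0) P P
  Yt_unbounded : ∀ x : ℝ, 0 < x → 0 < P {ω | ENNReal.ofReal x ≤ m.Yt 0 ω}
  indep : iIndep ![⨆ t, m.F t,
    ⨆ i, MeasurableSpace.comap (m.τ i) inferInstance,
    ⨆ i, MeasurableSpace.comap (m.Yt i) inferInstance] P

/-- The class `𝒳(X₀, T)` of admissible strategies. -/
structure IsAdmissible (P : Measure Ω) (X0 : ℝ) (T : ℝ≥0) (χ : DarkPoolStrategy Ω) : Prop where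
  Ξ_mem : χ.Ξ ∈ Icc 0 |χ.Xhat|
  ρ_stopping : IsStoppingTime (m.G χ.Xhat χ.Ξ) (fun ω => (χ.ρ ω : WithTop ℝ≥0))
  ρ_lt : ∀ᵐ ω ∂P, χ.ρ ω < T
  ξ_predictable : IsStronglyPredictable (m.G χ.Xhat χ.Ξ) χ.ξ
  ξ_integrable : ∀ᵐ ω ∂P,
    IntervalIntegrable (fun s : ℝ => χ.ξ s.toNNReal ω) volume 0 T
  ξ_bounded : ∃ K : ℝ, ∀ᵐ ω ∂P, ∀ t ≤ T, |χ.traded t ω| ≤ K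
  liquidation : ∀ᵐ ω ∂P, X0 + χ.traded T ω + m.Z χ.Xhat χ.Ξ (χ.ρ ω) ω = 0

/-- `P^χ_t`, the price at the exchange. -/
def exchangePrice (χ : DarkPoolStrategy Ω) (t : ℝ≥0) (ω : Ω) : ℝ :=
  m.P0 t ω + m.γ * χ.traded t ω + m.h (χ.ξ t ω)

/-- `P̂^χ_t`, the price at which an order arriving at time `t` is executed in the dark pool. -/
def darkPrice (χ : DarkPoolStrategy Ω) (t : ℝ≥0) (ω : Ω) : ℝ :=
  m.P0 t ω + m.γ * χ.traded t ω + m.κ * m.h (χ.ξ t ω)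

/-- `∫_0^T ξ_t P^χ_t dt`, the expenses at the exchange. As `ξ` need not be square integrable, this
can be `+∞`. -/
def exchangeExpenses (T : ℝ≥0) (χ : DarkPoolStrategy Ω) (ω : Ω) : EReal :=
  quasiIntegral (volume.restrict (Ioc (0 : ℝ) T))
    (fun t => ((χ.ξ t.toNNReal ω * m.exchangePrice χ t.toNNReal ω : ℝ) : EReal))

/-- The costs
`C_T = X₀ P⁰_0 + ∫_0^T ξ_t P^χ_t dt + α γ ∫_0^T Z^ρ_t ξ_t dt
  + ∑_{i ≤ N_ρ} Y_i (P̂^χ_{τ_i} + α γ Z_{τ_i-} + β(Y_i))`. -/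
def cost (X0 : ℝ) (T : ℝ≥0) (χ : DarkPoolStrategy Ω) (ω : Ω) : EReal :=
  ((X0 * m.P0 0 ω : ℝ) : EReal) + m.exchangeExpenses T χ ω +
    ((m.α * m.γ * (∫ t in (0 : ℝ)..T,
        m.Z χ.Xhat χ.Ξ (min (χ.ρ ω) t.toNNReal) ω * χ.ξ t.toNNReal ω) +
      ∑ i ∈ Finset.range (m.N (χ.ρ ω) ω), m.Y χ.Xhat χ.Ξ i ω *
        (m.darkPrice χ (m.τ i ω) ω +
          m.α * m.γ * Function.leftLim (fun t => m.Z χ.Xhat χ.Ξ t ω) (m.τ i ω) +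
          m.β (m.Y χ.Xhat χ.Ξ i ω)) : ℝ) : EReal)

/-- The expected costs `E[C_T]`, with values in `[-∞, ∞]`. -/
def expectedCost (P : Measure Ω) (X0 : ℝ) (T : ℝ≥0) (χ : DarkPoolStrategy Ω) : EReal :=
  quasiIntegral P (m.cost X0 T χ)

end DarkPoolModel

end

/-! Since `h x = η * x`, `α = κ = 0` and slippage vanishes, the costs split into a martingale part
`X₀ P⁰_0 + ∫ ξ P⁰ dt + ∑ Y_i P⁰_{τ_i}`, a permanent impact part `γ (A_T² / 2 + ∑ Y_i A_{τ_i})` with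
`A` = `traded`, and the temporary impact `η ∫ ξ² ≥ 0`, possibly infinite, which is dropped.

The martingale part has expectation zero. By independence `P⁰` remains a martingale when all arrival
times and order sizes are revealed at time `0` (`martingale_enlarged`). In that filtration every
trade is known when it is made, so each price may be replaced by `P⁰_T` under the expectation: by
Fubini at the exchange (`integral_exchange_expenses`), by optional sampling in the dark pool
(`integral_dark_pool_expenses`). This leaves `E[(X₀ + A_T + Z_ρ) P⁰_T] = 0` by liquidation.

The impact part is nonnegative almost surely (`impact_nonneg`). Let `s = ±1` with `s ξ ≤ 0`. If dark
pool and exchange trade in the same direction, every `Y_i A_{τ_i}` is nonnegative. If they trade in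
opposite directions, the key fact is `ae_not_overtraded`: `s (X₀ + A + ∑_{j<i} Y_j) ≥ 0` at `τ_i`.
From a position of the wrong sign, with positive probability no further order arrives before `T`,
and one-sided trading at the exchange can then no longer liquidate. Summation turns this into the
lower bound `γ X₀² / 2`. -/

/-! ### Quasi-integrals, and independence of joined σ-algebras -/

section General

variable {Ω : Type*} {mΩ : MeasurableSpace Ω} {P : Measure Ω}

/-- An integrable minorant keeps the negative part finite, so no undefined `⊤ - ⊤` can occur. Used
for the time integral and again for the expectation, as both may be `+∞`. -/
lemma le_quasiIntegral {f : Ω → EReal} {g : Ω → ℝ} (hg : Integrable g P)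
    (h : ∀ᵐ x ∂P, ((g x : ℝ) : EReal) ≤ f x) :
    ((∫ x, g x ∂P : ℝ) : EReal) ≤ quasiIntegral P f := by
  have hp : ∫⁻ x, ENNReal.ofReal (g x) ∂P ≤ ∫⁻ x, (f x).toENNReal ∂P := by
    refine lintegral_mono_ae (h.mono fun x hx => ?_)
    simpa using EReal.toENNReal_le_toENNReal hx
  have hn : ∫⁻ x, (-f x).toENNReal ∂P ≤ ∫⁻ x, ENNReal.ofReal (-g x) ∂P := by
    refine lintegral_mono_ae (h.mono fun x hx => ?_)
    have := EReal.toENNReal_le_toENNReal (EReal.neg_le_neg_iff.2 hx)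
    rw [← EReal.coe_neg] at this
    simpa using this
  have hfin : ∫⁻ x, ENNReal.ofReal (g x) ∂P ≠ ⊤ := hg.lintegral_lt_top.ne
  have hfin' : ∫⁻ x, ENNReal.ofReal (-g x) ∂P ≠ ⊤ := hg.neg.lintegral_lt_top.ne
  rw [integral_eq_lintegral_pos_part_sub_lintegral_neg_part hg, EReal.coe_sub,
    EReal.coe_ennreal_toReal hfin, EReal.coe_ennreal_toReal hfin']
  exact EReal.sub_le_sub (EReal.coe_ennreal_le_coe_ennreal_iff.2 hp)
    (EReal.coe_ennreal_le_coe_ennreal_iff.2 hn)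

lemma isPiSystem_inter_measurableSets (m₁ m₂ : MeasurableSpace Ω) :
    IsPiSystem {s | ∃ A B, MeasurableSet[m₁] A ∧ MeasurableSet[m₂] B ∧ s = A ∩ B} := by
  rintro _ ⟨A, B, hA, hB, rfl⟩ _ ⟨A', B', hA', hB', rfl⟩ -
  exact ⟨A ∩ A', B ∩ B', hA.inter hA', hB.inter hB', inter_inter_inter_comm A B A' B'⟩

lemma sup_eq_generateFrom_inter (m₁ m₂ : MeasurableSpace Ω) :
    m₁ ⊔ m₂ = MeasurableSpace.generateFrom
      {s | ∃ A B, MeasurableSet[m₁] A ∧ MeasurableSet[m₂] B ∧ s = A ∩ B} := by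
  refine le_antisymm (sup_le (fun A hA => ?_) (fun B hB => ?_))
    (MeasurableSpace.generateFrom_le ?_)
  · exact MeasurableSpace.measurableSet_generateFrom
      ⟨A, univ, hA, MeasurableSet.univ, (inter_univ A).symm⟩
  · exact MeasurableSpace.measurableSet_generateFrom
      ⟨univ, B, MeasurableSet.univ, hB, (univ_inter B).symm⟩
  · rintro _ ⟨A, B, hA, hB, rfl⟩
    exact (le_sup_left (a := m₁) (b := m₂) _ hA).inter (le_sup_right (a := m₁) (b := m₂) _ hB)

lemma indep_sup_left_of_indep [IsProbabilityMeasure P] {m₁ m₂ m₃ : MeasurableSpace Ω}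
    (h₁ : m₁ ≤ mΩ) (h₂ : m₂ ≤ mΩ) (h₃ : m₃ ≤ mΩ) (h : Indep m₁ (m₂ ⊔ m₃) P)
    (h' : Indep m₂ m₃ P) : Indep (m₁ ⊔ m₂) m₃ P := by
  refine IndepSets.indep (sup_le h₁ h₂) h₃ (isPiSystem_inter_measurableSets m₁ m₂)
    (@MeasurableSpace.isPiSystem_measurableSet Ω m₃) (sup_eq_generateFrom_inter m₁ m₂)
    (@MeasurableSpace.generateFrom_measurableSet Ω m₃).symm ?_
  rw [IndepSets_iff]
  rintro _ C ⟨A, B, hA, hB, rfl⟩ hC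
  have hB' : MeasurableSet[m₂ ⊔ m₃] B := le_sup_left (a := m₂) (b := m₃) _ hB
  have hC' : MeasurableSet[m₂ ⊔ m₃] C := le_sup_right (a := m₂) (b := m₃) _ hC
  rw [Indep_iff] at h h'
  rw [inter_assoc, h A _ hA (hB'.inter hC'), h' B C hB hC, h A B hA hB', mul_assoc]

/-- Information independent of everything that determines `f` and `m` does not improve the
prediction of `f`. On the generating sets `A ∩ B` the integrals of `f` and of `P[f | m]` both factor
as (integral over `A`) times `P B`. -/
lemma condExp_sup_of_indep [IsProbabilityMeasure P] {m m' H : MeasurableSpace Ω} {f : Ω → ℝ}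
    (hm : m ≤ m') (hm' : m' ≤ mΩ) (hH : H ≤ mΩ) (h : Indep m' H P)
    (hf : StronglyMeasurable[m'] f) (hfi : Integrable f P) :
    P[f | m ⊔ H] =ᵐ[P] P[f | m] := by
  have hmΩ := hm.trans hm'
  have hprod : ∀ (g : Ω → ℝ), StronglyMeasurable[m'] g → Integrable g P → ∀ A B,
      MeasurableSet[m] A → MeasurableSet[H] B →
      ∫ x in A ∩ B, g x ∂P = (∫ x in A, g x ∂P) * P.real B := by
    intro g hg hgi A B hA hB
    have hB' := hH _ hB
    have hA' := hmΩ _ hA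
    have hi : IndepFun (A.indicator g) (B.indicator (fun _ => (1 : ℝ))) P := by
      rw [IndepFun_iff_Indep]
      refine indep_of_indep_of_le_left (indep_of_indep_of_le_right h ?_) ?_
      · exact ((@measurable_const _ _ _ H (1 : ℝ)).indicator hB).comap_le
      · exact (hg.measurable.indicator (hm _ hA)).comap_le
    have := hi.integral_mul_eq_mul_integral (hgi.indicator hA').aestronglyMeasurable
      ((integrable_const (1 : ℝ)).indicator hB').aestronglyMeasurable
    rw [integral_indicator hA', integral_indicator hB'] at this
    simp only [integral_const, smul_eq_mul, mul_one, measureReal_restrict_apply_univ] at this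
    rw [← this, ← integral_indicator (hA'.inter hB')]
    congr 1
    ext x
    by_cases h1 : x ∈ A <;> by_cases h2 : x ∈ B <;> simp [h1, h2]
  refine (ae_eq_condExp_of_forall_setIntegral_eq (sup_le hmΩ hH) hfi
    (fun s _ _ => integrable_condExp.integrableOn) ?_
    (stronglyMeasurable_condExp.mono le_sup_left).aestronglyMeasurable).symm
  intro s hs _
  refine MeasurableSpace.induction_on_inter
    (C := fun s _ => ∫ x in s, (P[f | m]) x ∂P = ∫ x in s, f x ∂P)
    (sup_eq_generateFrom_inter m H) (isPiSystem_inter_measurableSets m H) ?_ ?_ ?_ ?_ s hs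
  · simp
  · rintro _ ⟨A, B, hA, hB, rfl⟩
    rw [hprod _ (stronglyMeasurable_condExp.mono hm) integrable_condExp A B hA hB,
      hprod f hf hfi A B hA hB, setIntegral_condExp hmΩ hfi hA]
  · intro t ht hC
    have ht' := sup_le hmΩ hH _ ht
    rw [setIntegral_compl ht' integrable_condExp, setIntegral_compl ht' hfi, hC,
      integral_condExp hmΩ]
  · intro g hd hg hC
    have hg' := fun i => sup_le hmΩ hH _ (hg i)
    rw [integral_iUnion hg' hd integrable_condExp.integrableOn,
      integral_iUnion hg' hd hfi.integrableOn]
    exact tsum_congr hC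

end General

/-! ### Independence of the past of a process from a later increment -/

section Increments

variable {Ω : Type*} {mΩ : MeasurableSpace Ω} {P : Measure Ω} [IsProbabilityMeasure P]

/-- It suffices to treat finitely many past times. On a grid containing them, each past value is a
telescoping sum of increments that are independent of the last one. -/
lemma ProbabilityTheory.HasIndepIncrements.indepFun_past_sub {X : ℝ≥0 → Ω → ℝ}
    (hX : HasIndepIncrements X P) (hm : ∀ t, Measurable (X t)) (h0 : ∀ᵐ ω ∂P, X 0 ω = 0)
    {u v : ℝ≥0} (huv : u ≤ v) :
    IndepFun (fun ω (s : Iic u) => X s ω) (fun ω => X v ω - X u ω) P := by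
  refine IndepFun.process_indepFun (fun s => hm s) ((hm v).sub (hm u)) fun I => ?_
  classical
  -- The point `0` starts the telescoping sums, where `X 0 = 0` a.s.; the point `u` makes `X v - X
  -- u` the increment right after the last grid point.
  let J : Finset ℝ≥0 := insert 0 (insert u (I.image Subtype.val))
  have hJu : ∀ x ∈ J, x ≤ u := by
    intro x hx
    simp only [J, Finset.mem_insert, Finset.mem_image] at hx
    rcases hx with rfl | rfl | ⟨y, -, rfl⟩
    · exact zero_le
    · exact le_rfl
    · exact y.2
  have hJpos : 0 < J.card := Finset.card_pos.2 ⟨0, Finset.mem_insert_self _ _⟩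
  let n := J.card - 1
  have hn : J.card = n + 1 := by omega
  let e : Fin (n + 1) ≃o J := J.orderIsoOfFin hn
  let t : ℕ → ℝ≥0 := fun k => if h : k < n + 1 then (e ⟨k, h⟩ : ℝ≥0) else v
  have ht : Monotone t := by
    intro a b hab
    simp only [t]
    split_ifs with h1 h2 h2
    · exact_mod_cast e.monotone (by simpa using hab)
    · exact (hJu _ (e _).2).trans huv
    · omega
    · exact le_rfl
  have ht0 : t 0 = 0 := by
    obtain ⟨k, hk⟩ := e.surjective ⟨0, Finset.mem_insert_self _ _⟩
    have h1 : t 0 ≤ t k := ht (Nat.zero_le _)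
    have h2 : t k = 0 := by simp only [t, k.2, dif_pos, Fin.eta, hk]
    exact le_antisymm (h2 ▸ h1) zero_le
  have htn : t n = u := by
    obtain ⟨k, hk⟩ := e.surjective ⟨u, Finset.mem_insert_of_mem (Finset.mem_insert_self _ _)⟩
    have h1 : t k ≤ t n := ht (by omega)
    have h2 : t k = u := by simp only [t, k.2, dif_pos, Fin.eta, hk]
    have h3 : t n ≤ u := by simpa [t] using hJu _ (e ⟨n, by omega⟩).2
    exact le_antisymm h3 (h2 ▸ h1)
  have htn1 : t (n + 1) = v := by simp [t]
  have hi := (hX.nat ht).indepFun_finset (Finset.range n) {n} (by simp)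
    (fun i => (hm _).sub (hm _))
  have hidx : ∀ s : I, ∃ k : ℕ, k ≤ n ∧ t k = s := by
    intro s
    have hs : (s : ℝ≥0) ∈ J := Finset.mem_insert_of_mem (Finset.mem_insert_of_mem
      (Finset.mem_image_of_mem _ s.2))
    obtain ⟨k, hk⟩ := e.surjective ⟨_, hs⟩
    exact ⟨k, by omega, by simp only [t, k.2, dif_pos, Fin.eta, hk]⟩
  choose k hkn hk using hidx
  have hφ : Measurable (fun (x : Finset.range n → ℝ) (s : I) =>
      ∑ j : Finset.range n, if (j : ℕ) < k s then x j else 0) := by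
    refine measurable_pi_iff.2 fun s => Finset.measurable_sum _ fun j _ => ?_
    split_ifs
    · exact measurable_pi_apply j
    · exact measurable_const
  have hψ : Measurable (fun (x : ({n} : Finset ℕ) → ℝ) => x ⟨n, by simp⟩) :=
    measurable_pi_apply _
  have h2 := hi.comp hφ hψ
  refine h2.congr ?_ ?_
  · filter_upwards [h0] with ω hω
    funext s
    have h3 := Finset.sum_range_sub (fun j => X (t j) ω) (k s)
    rw [ht0, hω, sub_zero, hk] at h3
    simp only [Function.comp_apply]
    rw [← h3]
    have := Finset.sum_coe_sort (Finset.range n)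
      (fun j => if j < k s then X (t (j + 1)) ω - X (t j) ω else 0)
    rw [this, ← Finset.sum_filter]
    congr 1
    ext j
    have := hkn s
    simp only [Finset.mem_filter, Finset.mem_range]
    omega
  · filter_upwards with ω
    simp [htn, htn1]

end Increments

/-! ### Measurability of arrivals and executions with respect to sub-σ-algebras -/

namespace DarkPoolModel

section Measurability

/-- A model with the given incoming orders and with trivial remaining data. -/
def ofOrders {Ω : Type*} (𝒦 : MeasurableSpace Ω) (τ : ℕ → Ω → ℝ≥0) (Yt : ℕ → Ω → ℝ≥0∞)
    (hτ : ∀ i, Measurable (τ i)) (hY : ∀ i, Measurable (Yt i)) : DarkPoolModel Ω where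
  F := ⊥
  γ := 0
  h := 0
  P0 := 0
  α := 0
  β := 0
  κ := 0
  τ := τ
  Yt := Yt
  measurable_τ := hτ
  measurable_Yt := hY

variable {Ω : Type*} (𝒦 : MeasurableSpace Ω) [mΩ : MeasurableSpace Ω] (m : DarkPoolModel Ω)

/-- `Y` depends on the order sizes only, so `measurable_Y` can be applied to an auxiliary model
living on `𝒦`. -/
lemma measurable_Y_of (hY : ∀ i, Measurable[𝒦] (m.Yt i))
    (Xhat Ξ : ℝ) (i : ℕ) : Measurable[𝒦] (m.Y Xhat Ξ i) := by
  let m' := ofOrders 𝒦 (fun _ _ => 0) m.Yt (fun _ => @measurable_const _ _ _ 𝒦 _) hY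
  have hf : ∀ i, @filled Ω 𝒦 m' Xhat Ξ i = m.filled Xhat Ξ i := by
    intro i
    induction i with
    | zero => rfl
    | succ i ih =>
      funext ω
      simp only [filled, ih]
      rfl
  have : @Y Ω 𝒦 m' Xhat Ξ i = m.Y Xhat Ξ i := by
    funext ω
    simp only [Y, hf]
    rfl
  exact this ▸ @measurable_Y Ω 𝒦 m' Xhat Ξ i

/-- `N t` sees the arrival times only through the events `τ i ≤ t`. The auxiliary model therefore
uses two-valued arrival times, `0` or `t + 1`. -/
lemma measurable_N_of (t : ℝ≥0)
    (hτ : ∀ i, MeasurableSet[𝒦] {ω | m.τ i ω ≤ t}) : Measurable[𝒦] (m.N t) := by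
  classical
  let m' := ofOrders 𝒦 (fun i ω => if m.τ i ω ≤ t then 0 else t + 1) (fun _ _ => 0)
    (fun i => @Measurable.ite _ _ (fun _ => 0) (fun _ => t + 1) 𝒦 _ _ _ (hτ i)
      (@measurable_const _ _ _ 𝒦 _) (@measurable_const _ _ _ 𝒦 _)) (fun _ => @measurable_const _ _ _ 𝒦 _)
  have hN : @N Ω 𝒦 m' t = m.N t := by
    funext ω
    have : ∀ i, @DarkPoolModel.τ Ω 𝒦 m' i ω ≤ t ↔ m.τ i ω ≤ t := by
      intro i
      change (if m.τ i ω ≤ t then (0 : ℝ≥0) else t + 1) ≤ t ↔ _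
      split_ifs with h <;> simp [h]
    simp only [N, this]
  exact hN ▸ @measurable_N Ω 𝒦 m' t

lemma measurable_Z_of (t : ℝ≥0)
    (hτ : ∀ i, MeasurableSet[𝒦] {ω | m.τ i ω ≤ t}) (hY : ∀ i, Measurable[𝒦] (m.Yt i))
    (Xhat Ξ : ℝ) : Measurable[𝒦] (m.Z Xhat Ξ t) := by
  intro B hB
  have : m.Z Xhat Ξ t ⁻¹' B = ⋃ n : ℕ, m.N t ⁻¹' {n} ∩
      (fun ω => ∑ i ∈ Finset.range n, m.Y Xhat Ξ i ω) ⁻¹' B := by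
    ext ω
    simp [Z]
  rw [this]
  refine @MeasurableSet.iUnion _ _ 𝒦 _ _ fun n => @MeasurableSet.inter _ 𝒦 _ _
    (m.measurable_N_of 𝒦 t hτ (measurableSet_singleton n))
    ((@Finset.measurable_sum _ _ _ _ _ _ 𝒦 _ (Finset.range n)
      fun i _ => m.measurable_Y_of 𝒦 hY Xhat Ξ i) hB)

/-- The strict inequality `s < t` pays for the right-continuous regularisation: `G s` is an
intersection over later times. -/
lemma G_le {Xhat Ξ : ℝ} {s t : ℝ≥0} (hst : s < t) (hF : m.F t ≤ 𝒦)
    (hτ : ∀ i, ∀ r ≤ t, MeasurableSet[𝒦] {ω | m.τ i ω ≤ r})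
    (hY : ∀ i, Measurable[𝒦] (m.Yt i)) : m.G Xhat Ξ s ≤ 𝒦 := by
  rw [G, Filtration.rightCont_eq]
  refine (iInf₂_le t hst).trans (sup_le (sup_le hF ?_) ?_)
  · exact iSup₂_le fun r hr =>
      (m.measurable_Z_of 𝒦 r (fun i => hτ i r hr) hY Xhat Ξ).comap_le
  · refine sSup_le ?_
    rintro _ ⟨_, ⟨i, rfl⟩, rfl⟩
    refine iSup₂_le fun r hr => Measurable.comap_le ?_
    refine @measurable_of_Iic _ _ _ _ _ 𝒦 _ _ _ _ fun a => ?_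
    by_cases ha : r ≤ a
    · convert! @MeasurableSet.univ Ω 𝒦
      ext ω
      simp [ha]
    · convert! hτ i a ((not_le.1 ha).le.trans hr) using 1
      ext ω
      simp [ha]

end Measurability

end DarkPoolModel

/-! ### Arrival times of the Poisson process -/

namespace DarkPoolModel

section Arrivals

variable {Ω : Type*} [mΩ : MeasurableSpace Ω] (m : DarkPoolModel Ω)

lemma lt_N_iff_of_bddAbove {ω : Ω} {t : ℝ≥0} (hτ : StrictMono fun i => m.τ i ω)
    (hb : BddAbove {k : ℕ | ∃ i, k = i + 1 ∧ m.τ i ω ≤ t}) (i : ℕ) :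
    i < m.N t ω ↔ m.τ i ω ≤ t := by
  constructor
  · intro h
    have hne : {k : ℕ | ∃ i, k = i + 1 ∧ m.τ i ω ≤ t}.Nonempty := by
      by_contra hne
      rw [not_nonempty_iff_eq_empty] at hne
      rw [N, hne] at h
      simp at h
    obtain ⟨j, hj, hle⟩ := Nat.sSup_mem hne hb
    rw [N, hj] at h
    exact (hτ.monotone (Nat.lt_succ_iff.1 h)).trans hle
  · exact fun h => le_csSup hb ⟨i, rfl, h⟩

variable {m} {P : Measure Ω} {θ : ℝ≥0}

lemma ae_N_le_N (hP : IsPoissonProcess m.N θ P) {s t : ℝ≥0} (hst : s ≤ t) :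
    ∀ᵐ ω ∂P, m.N s ω ≤ m.N t ω := by
  have hm : Measurable (fun ω => (m.N t ω : ℝ) - (m.N s ω : ℝ)) :=
    (measurable_from_top.comp (m.measurable_N t)).sub
      (measurable_from_top.comp (m.measurable_N s))
  have h : ∀ᵐ x ∂(P.map (fun ω => (m.N t ω : ℝ) - (m.N s ω : ℝ))), 0 ≤ x := by
    rw [hP.law s t hst, ae_map_iff measurable_from_top.aemeasurable measurableSet_Ici]
    exact Eventually.of_forall fun n => Nat.cast_nonneg n
  refine (ae_of_ae_map hm.aemeasurable h).mono fun ω hω => ?_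
  exact_mod_cast sub_nonneg.1 hω

/-- The content is non-explosion. With infinitely many arrivals up to `t`, the supremum of an
unbounded set would give `N = 0` after `t` by default, although `N ≥ 1` between the first two
arrivals; but `N` is a.s. monotone along a countable dense set of times. -/
lemma ae_lt_N_iff (hP : IsPoissonProcess m.N θ P)
    (hτ : ∀ᵐ ω ∂P, StrictMono (fun i => m.τ i ω)) :
    ∀ᵐ ω ∂P, ∀ t i, i < m.N t ω ↔ m.τ i ω ≤ t := by
  obtain ⟨D, hDc, hD⟩ := TopologicalSpace.exists_countable_dense ℝ≥0
  have hmono : ∀ᵐ ω ∂P, ∀ s ∈ D, ∀ t ∈ D, s ≤ t → m.N s ω ≤ m.N t ω := by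
    rw [ae_ball_iff hDc]
    intro s _
    rw [ae_ball_iff hDc]
    intro t _
    by_cases hst : s ≤ t
    · exact (ae_N_le_N hP hst).mono fun _ h _ => h
    · exact Eventually.of_forall fun _ h => absurd h hst
  filter_upwards [hτ, hmono] with ω hω hmω t i
  refine m.lt_N_iff_of_bddAbove hω ?_ i
  by_contra hb
  have hall : ∀ j, m.τ j ω ≤ t := by
    intro j
    obtain ⟨_, ⟨k, rfl, hk⟩, hjk⟩ := not_bddAbove_iff.1 hb (j + 1)
    exact (hω.monotone (by omega)).trans hk
  obtain ⟨s, hsD, hs0, hs1⟩ := hD.exists_between (hω (Nat.lt_add_one 0))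
  obtain ⟨t', htD, ht, -⟩ := hD.exists_between (lt_add_one t)
  have h1 : 0 < m.N s ω := by
    refine (m.lt_N_iff_of_bddAbove hω ⟨1, ?_⟩ 0).2 hs0.le
    rintro _ ⟨j, rfl, hj⟩
    by_contra hj1
    have : m.τ 1 ω ≤ m.τ j ω := hω.monotone (by omega)
    exact absurd (this.trans hj) (not_le.2 hs1)
  have h2 : m.N t' ω = 0 := by
    rw [N, Nat.sSup_of_not_bddAbove]
    rw [not_bddAbove_iff]
    exact fun n => ⟨n + 1, ⟨n, rfl, (hall n).trans ht.le⟩, n.lt_add_one⟩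
  have := hmω s hsD t' htD (hs1.le.trans ((hall 1).trans ht.le))
  omega

lemma measure_N_eq_pos (hP : IsPoissonProcess m.N θ P) {s t : ℝ≥0} (hst : s ≤ t) :
    0 < P {ω | (m.N t ω : ℝ) - (m.N s ω : ℝ) = 0} := by
  have hm : Measurable (fun ω => (m.N t ω : ℝ) - (m.N s ω : ℝ)) :=
    (measurable_from_top.comp (m.measurable_N t)).sub
      (measurable_from_top.comp (m.measurable_N s))
  have h := Measure.map_apply hm (measurableSet_singleton (0 : ℝ)) (μ := P)
  rw [hP.law s t hst, Measure.map_apply measurable_from_top (measurableSet_singleton _)] at h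
  have h0 : (Nat.cast : ℕ → ℝ) ⁻¹' {0} = {0} := by
    ext n
    simp
  rw [h0, poissonMeasure_singleton] at h
  change 0 < P ((fun ω => (m.N t ω : ℝ) - (m.N s ω : ℝ)) ⁻¹' {0})
  rw [← h]
  simp [Real.exp_pos]

end Arrivals

/-! ### Enlarged filtrations and the independence of future arrivals -/

section Filtrations

variable {Ω : Type*} [mΩ : MeasurableSpace Ω] (m : DarkPoolModel Ω)

/-- The σ-algebra generated by all arrival times. -/
abbrev timesSigma : MeasurableSpace Ω := ⨆ i, MeasurableSpace.comap (m.τ i) inferInstance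

/-- The σ-algebra generated by all order sizes. -/
abbrev sizesSigma : MeasurableSpace Ω := ⨆ i, MeasurableSpace.comap (m.Yt i) inferInstance

/-- The σ-algebra generated by the events `τ_i ≤ s` with `s ≤ u`. -/
abbrev pastTimesSigma (u : ℝ≥0) : MeasurableSpace Ω :=
  MeasurableSpace.comap (fun ω (p : ℕ × Iic u) => m.τ p.1 ω ≤ p.2) inferInstance

lemma timesSigma_le : m.timesSigma ≤ mΩ := iSup_le fun i => (m.measurable_τ i).comap_le

lemma sizesSigma_le : m.sizesSigma ≤ mΩ := iSup_le fun i => (m.measurable_Yt i).comap_le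

lemma iSup_F_le : (⨆ t, m.F t) ≤ mΩ := iSup_le fun t => m.F.le t

lemma measurable_τ_timesSigma (i : ℕ) : Measurable[m.timesSigma] (m.τ i) :=
  Measurable.of_comap_le (le_iSup (fun i => MeasurableSpace.comap (m.τ i) inferInstance) i)

lemma measurable_Yt_sizesSigma (i : ℕ) : Measurable[m.sizesSigma] (m.Yt i) :=
  Measurable.of_comap_le (le_iSup (fun i => MeasurableSpace.comap (m.Yt i) inferInstance) i)

lemma measurableSet_pastTimesSigma {u r : ℝ≥0} (hr : r ≤ u) (i : ℕ) :
    MeasurableSet[m.pastTimesSigma u] {ω | m.τ i ω ≤ r} :=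
  ⟨{f | f (i, ⟨r, hr⟩)}, measurableSet_setOfPred.2 (measurable_pi_apply _), rfl⟩

lemma pastTimesSigma_le (u : ℝ≥0) : m.pastTimesSigma u ≤ m.timesSigma := by
  refine Measurable.comap_le (@measurable_pi_iff _ _ _ m.timesSigma _ _ |>.2 fun p => ?_)
  exact (@measurableSet_setOfPred _ m.timesSigma _).1 (m.measurable_τ_timesSigma p.1 measurableSet_Iic)

/-- The filtration `(ℱ_t)` enlarged initially by all arrival times and order sizes. -/
def enlarged : Filtration ℝ≥0 mΩ where
  seq t := m.F t ⊔ (m.timesSigma ⊔ m.sizesSigma)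
  mono' _ _ h := sup_le_sup_right (m.F.mono h) _
  le' t := sup_le (m.F.le t) (sup_le m.timesSigma_le m.sizesSigma_le)

lemma timesSigma_le_enlarged (t : ℝ≥0) : m.timesSigma ≤ m.enlarged t :=
  le_sup_left.trans le_sup_right

lemma sizesSigma_le_enlarged (t : ℝ≥0) : m.sizesSigma ≤ m.enlarged t :=
  le_sup_right.trans le_sup_right

lemma G_le_enlarged {Xhat Ξ : ℝ} {s t : ℝ≥0} (hst : s < t) :
    m.G Xhat Ξ s ≤ m.enlarged t :=
  m.G_le _ hst le_sup_left
    (fun i _ _ => m.timesSigma_le_enlarged t _ (m.measurable_τ_timesSigma i measurableSet_Iic))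
    (fun i => (m.measurable_Yt_sizesSigma i).mono (m.sizesSigma_le_enlarged t) le_rfl)

/-- The exchange, the order sizes and the arrivals up to time `u`. -/
abbrev arrivalsUntil (u : ℝ≥0) : MeasurableSpace Ω :=
  ((⨆ t, m.F t) ⊔ m.sizesSigma) ⊔ m.pastTimesSigma u

lemma G_le_arrivalsUntil {Xhat Ξ : ℝ} {s u : ℝ≥0} (hsu : s < u) :
    m.G Xhat Ξ s ≤ m.arrivalsUntil u :=
  m.G_le _ hsu ((le_iSup (fun t => m.F t) u).trans (le_sup_left.trans le_sup_left))
    (fun i _ hr => le_sup_right (a := (⨆ t, m.F t) ⊔ m.sizesSigma) _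
      (m.measurableSet_pastTimesSigma hr i))
    (fun i => (m.measurable_Yt_sizesSigma i).mono (le_sup_right.trans le_sup_left) le_rfl)

lemma measurable_N_arrivalsUntil {s u : ℝ≥0} (hsu : s ≤ u) :
    Measurable[m.arrivalsUntil u] (m.N s) :=
  m.measurable_N_of _ s fun i => le_sup_right (a := (⨆ t, m.F t) ⊔ m.sizesSigma) _
      (m.measurableSet_pastTimesSigma hsu i)

lemma measurable_Y_arrivalsUntil (u : ℝ≥0) (Xhat Ξ : ℝ) (i : ℕ) :
    Measurable[m.arrivalsUntil u] (m.Y Xhat Ξ i) :=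
  m.measurable_Y_of (m.arrivalsUntil u) (fun i => (m.measurable_Yt_sizesSigma i).mono
    ((le_sup_right (a := ⨆ t, m.F t)).trans le_sup_left) le_rfl) Xhat Ξ i

variable {m} {P : Measure Ω} {θ : ℝ≥0}

lemma HasPoissonOrders.indep_exchange_orders (h : m.HasPoissonOrders P θ) :
    Indep (⨆ t, m.F t) (m.timesSigma ⊔ m.sizesSigma) P := by
  have h1 := indep_iSup_of_disjoint (S := {0}) (T := {1, 2}) (by
    intro i
    fin_cases i
    · exact m.iSup_F_le
    · exact m.timesSigma_le
    · exact m.sizesSigma_le) h.indep (by simp)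
  simp only [iSup_singleton, iSup_insert, Matrix.cons_val] at h1
  exact h1

lemma HasPoissonOrders.indep_exchange_sizes_times (h : m.HasPoissonOrders P θ) :
    Indep ((⨆ t, m.F t) ⊔ m.sizesSigma) m.timesSigma P := by
  have h1 := indep_iSup_of_disjoint (S := {0, 2}) (T := {1}) (by
    intro i
    fin_cases i
    · exact m.iSup_F_le
    · exact m.timesSigma_le
    · exact m.sizesSigma_le) h.indep (by simp)
  simp only [iSup_singleton, iSup_insert, Matrix.cons_val] at h1
  exact h1

variable [IsProbabilityMeasure P]

/-- The added σ-algebras are independent of the whole exchange. The gain is that every `τ i` becomes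
measurable at time `0`. -/
lemma martingale_enlarged (hAC : m.IsAlmgrenChriss P) (h : m.HasPoissonOrders P θ) :
    Martingale m.P0 m.enlarged P := by
  refine ⟨fun t => (hAC.martingale.1 t).mono le_sup_left, fun s t hst => ?_⟩
  refine (condExp_sup_of_indep (m' := ⨆ t, m.F t) (le_iSup (fun t => m.F t) s) m.iSup_F_le
    (sup_le m.timesSigma_le m.sizesSigma_le) h.indep_exchange_orders
    ((hAC.martingale.1 t).mono (le_iSup (fun t => m.F t) t))
    (hAC.martingale.integrable t)).trans (hAC.martingale.2 s t hst)

/-- Arrivals up to `u` are a.s. functions of `N` on `[0, u]`, hence independent of the increment.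
Exchange and sizes join because they are independent of all arrival times together. -/
lemma HasPoissonOrders.indep_arrivalsUntil (h : m.HasPoissonOrders P θ) {u v : ℝ≥0}
    (huv : u ≤ v) : Indep (m.arrivalsUntil u)
      (MeasurableSpace.comap (fun ω => (m.N v ω : ℝ) - (m.N u ω : ℝ)) inferInstance) P := by
  have hN : ∀ t, Measurable[m.timesSigma] (fun ω => (m.N t ω : ℝ)) := fun t =>
    measurable_from_top.comp
      (m.measurable_N_of _ t fun i => m.measurable_τ_timesSigma i measurableSet_Iic)
  have hle : MeasurableSpace.comap (fun ω => (m.N v ω : ℝ) - (m.N u ω : ℝ)) inferInstance ≤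
      m.timesSigma := ((hN v).sub (hN u)).comap_le
  have hp : IndepFun (fun ω (p : ℕ × Iic u) => m.τ p.1 ω ≤ p.2)
      (fun ω => (m.N v ω : ℝ) - (m.N u ω : ℝ)) P := by
    have h0 : ∀ᵐ ω ∂P, (m.N 0 ω : ℝ) = 0 := h.poisson.zero.mono fun ω hω => by simp [hω]
    have h1 := h.poisson.indep.indepFun_past_sub
      (fun t => (hN t).mono m.timesSigma_le le_rfl) h0 huv
    have hφ : Measurable (fun (x : Iic u → ℝ) (p : ℕ × Iic u) => (p.1 : ℝ) < x p.2) :=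
      measurable_pi_iff.2 fun p => measurableSet_setOfPred.1
        (measurableSet_lt measurable_const (measurable_pi_apply p.2))
    refine (h1.comp hφ measurable_id).congr ?_ ae_eq_rfl
    filter_upwards [ae_lt_N_iff h.poisson (h.τ_increasing.mono fun _ h => h.2)] with ω hω
    funext p
    simp [hω]
  refine indep_sup_left_of_indep (sup_le m.iSup_F_le m.sizesSigma_le)
    ((m.pastTimesSigma_le u).trans m.timesSigma_le) (hle.trans m.timesSigma_le) ?_ hp
  exact indep_of_indep_of_le_right h.indep_exchange_sizes_times
    (sup_le (m.pastTimesSigma_le u) hle)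

/-- The event of no arrival in `(u, v]` is independent of `D` and has positive probability. -/
lemma HasPoissonOrders.measure_eq_zero_of_inter (h : m.HasPoissonOrders P θ) {u v : ℝ≥0}
    (huv : u ≤ v) {D : Set Ω} (hD : MeasurableSet[m.arrivalsUntil u] D)
    (h0 : P (D ∩ {ω | m.N v ω = m.N u ω}) = 0) : P D = 0 := by
  have hset : {ω | m.N v ω = m.N u ω} = {ω | (m.N v ω : ℝ) - (m.N u ω : ℝ) = 0} := by
    ext ω
    simp [sub_eq_zero]
  have h1 := (Indep_iff _ _ P).1 (h.indep_arrivalsUntil huv) D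
    {ω | (m.N v ω : ℝ) - (m.N u ω : ℝ) = 0} hD ⟨{0}, measurableSet_singleton _, rfl⟩
  rw [← hset, h0] at h1
  rcases mul_eq_zero.1 h1.symm with h2 | h2
  · exact h2
  · exact absurd (hset ▸ h2) (measure_N_eq_pos h.poisson huv).ne'

end Filtrations

end DarkPoolModel

/-! ### Optional sampling with weights -/

section OptionalSampling

variable {Ω : Type*} {mΩ : MeasurableSpace Ω} {P : Measure Ω} [IsProbabilityMeasure P]

/-- The known factor `W` is pulled into the conditional expectation; the bound on absolute values is
the `L¹` contraction property. -/
lemma integral_mul_condExp_eq {m : MeasurableSpace Ω} (hm : m ≤ mΩ) {W f g : Ω → ℝ}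
    (hW : StronglyMeasurable[m] W) (hWf : Integrable (fun ω => W ω * f ω) P)
    (hf : Integrable f P) (hg : g =ᵐ[P] P[f | m]) :
    (fun ω => W ω * g ω) =ᵐ[P] P[fun ω => W ω * f ω | m] ∧
    Integrable (fun ω => W ω * g ω) P ∧ ∫ ω, W ω * g ω ∂P = ∫ ω, W ω * f ω ∂P ∧
      ∫ ω, |W ω * g ω| ∂P ≤ ∫ ω, |W ω * f ω| ∂P := by
  have h : (fun ω => W ω * g ω) =ᵐ[P] P[fun ω => W ω * f ω | m] := by
    refine EventuallyEq.trans ?_ (condExp_mul_of_stronglyMeasurable_left hW hWf hf).symm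
    filter_upwards [hg] with ω hω
    simp [hω]
  refine ⟨h, integrable_condExp.congr h.symm, ?_, ?_⟩
  · rw [integral_congr_ae h, integral_condExp hm]
  · have h' : (fun ω => |W ω * g ω|) =ᵐ[P]
        fun ω => |(P[fun ω => W ω * f ω | m]) ω| := h.mono fun ω hω => by simp only [hω]
    rw [integral_congr_ae h']
    exact integral_abs_condExp_le _

/-- Dyadic-type approximation from above. -/
lemma tendsto_ceil_mul_div (x : ℝ≥0) :
    Tendsto (fun n : ℕ => (⌈x * (n + 1)⌉₊ : ℝ≥0) / (n + 1)) atTop (𝓝[≥] x) := by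
  have hle : ∀ n : ℕ, x ≤ (⌈x * (n + 1)⌉₊ : ℝ≥0) / (n + 1) := by
    intro n
    rw [le_div_iff₀ (by positivity)]
    exact Nat.le_ceil _
  refine tendsto_nhdsWithin_iff.2 ⟨?_, Eventually.of_forall hle⟩
  have hup : ∀ n : ℕ, (⌈x * (n + 1)⌉₊ : ℝ≥0) / (n + 1) ≤ x + 1 / (n + 1) := by
    intro n
    have : (n : ℝ≥0) + 1 ≠ 0 := by positivity
    rw [div_le_iff₀ (by positivity), add_mul, one_div, inv_mul_cancel₀ this]
    exact (Nat.ceil_lt_add_one zero_le).le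
  refine tendsto_of_tendsto_of_tendsto_of_le_of_le tendsto_const_nhds ?_ hle hup
  have h1 : Tendsto (fun n : ℕ => (1 : ℝ≥0) / (n + 1)) atTop (𝓝 0) :=
    tendsto_one_div_add_atTop_nhds_zero_nat
  simpa using h1.const_add x

variable {K : Filtration ℝ≥0 mΩ} {M : ℝ≥0 → Ω → ℝ}

/-- Approximate `τ` from above by countably valued stopping times, apply optional sampling there,
and pass to the limit by right-continuity. `W` must be known at these later times, hence the form of
`hW`. The bound on absolute values serves to sum over the dark-pool orders. -/
lemma MeasureTheory.Martingale.stopped_weighted (hM : Martingale M K P)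
    (hrc : ∀ᵐ ω ∂P, ∀ t, ContinuousWithinAt (fun s => M s ω) (Ici t) t)
    {τ : Ω → ℝ≥0} {T : ℝ≥0} (hτ : Measurable[K 0] τ) (hτT : ∀ ω, τ ω ≤ T) {W : Ω → ℝ}
    (hW : ∀ (σ : Ω → ℝ≥0) (hσ : IsStoppingTime K (fun ω => (σ ω : WithTop ℝ≥0))),
      (∀ ω, τ ω ≤ σ ω) → StronglyMeasurable[hσ.measurableSpace] W)
    (hWM : Integrable (fun ω => W ω * M T ω) P) :
    Integrable (fun ω => W ω * M (τ ω) ω) P ∧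
      ∫ ω, W ω * M (τ ω) ω ∂P = ∫ ω, W ω * M T ω ∂P ∧
      ∫ ω, |W ω * M (τ ω) ω| ∂P ≤ ∫ ω, |W ω * M T ω| ∂P := by
  let σ : ℕ → Ω → ℝ≥0 := fun n ω => min ((⌈τ ω * (n + 1)⌉₊ : ℝ≥0) / (n + 1)) T
  have hσm : ∀ n, Measurable[K 0] (σ n) := fun n => by
    have : Measurable (fun x : ℝ≥0 => min ((⌈x * (n + 1)⌉₊ : ℝ≥0) / (n + 1)) T) := by
      fun_prop
    exact this.comp hτ
  have hσ : ∀ n, IsStoppingTime K (fun ω => (σ n ω : WithTop ℝ≥0)) := fun n t => by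
    simp only [WithTop.coe_le_coe]
    exact K.mono zero_le _ (hσm n measurableSet_Iic)
  have hτσ : ∀ n ω, τ ω ≤ σ n ω := by
    intro n ω
    refine le_min ?_ (hτT ω)
    rw [le_div_iff₀ (by positivity)]
    exact Nat.le_ceil _
  have hσT : ∀ n ω, (σ n ω : WithTop ℝ≥0) ≤ (T : WithTop ℝ≥0) := fun n ω =>
    WithTop.coe_le_coe.2 (min_le_right _ _)
  have hcount : ∀ n, (range fun ω => (σ n ω : WithTop ℝ≥0)).Countable := by
    intro n
    refine (countable_range fun k : ℕ =>
      ((min ((k : ℝ≥0) / (n + 1)) T : ℝ≥0) : WithTop ℝ≥0)).mono ?_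
    rintro _ ⟨ω, rfl⟩
    exact ⟨⌈τ ω * (n + 1)⌉₊, rfl⟩
  have hos : ∀ n, (fun ω => M (σ n ω) ω) =ᵐ[P] P[M T | (hσ n).measurableSpace] := fun n =>
    hM.stoppedValue_ae_eq_condExp_of_le_const_of_countable_range (hσ n) (hσT n) (hcount n)
  have hpull := fun n => integral_mul_condExp_eq (hσ n).measurableSpace_le
    (hW (σ n) (hσ n) (hτσ n)) hWM (hM.integrable T) (hos n)
  -- All approximations are conditional expectations of the single integrable variable `W * M T`;
  -- this upgrades a.e. convergence to convergence in `L¹`.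
  have hui : UniformIntegrable (fun n ω => W ω * M (σ n ω) ω) 1 P :=
    (hWM.uniformIntegrable_condExp fun n => (hσ n).measurableSpace_le).ae_eq
      fun n => (hpull n).1.symm
  have hlim : ∀ᵐ ω ∂P, Tendsto (fun n => W ω * M (σ n ω) ω) atTop (𝓝 (W ω * M (τ ω) ω)) := by
    filter_upwards [hrc] with ω hω
    refine Tendsto.const_mul _ ((hω (τ ω)).tendsto.comp ?_)
    refine tendsto_nhdsWithin_iff.2 ⟨?_, Eventually.of_forall fun n => hτσ n ω⟩
    have h1 := ((tendsto_ceil_mul_div (τ ω)).mono_right nhdsWithin_le_nhds).min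
      (tendsto_const_nhds (x := T))
    rwa [min_eq_left (hτT ω)] at h1
  have hint : Integrable (fun ω => W ω * M (τ ω) ω) P := hui.integrable_of_ae_tendsto hlim
  have hL1 := tendsto_Lp_finite_of_tendsto_ae le_rfl ENNReal.one_ne_top
    (fun n => (hpull n).2.1.aestronglyMeasurable) (memLp_one_iff_integrable.2 hint)
    hui.unifIntegrable hlim
  have h1 := tendsto_integral_of_L1' _ hint.aestronglyMeasurable (Eventually.of_forall fun n => (hpull n).2.1) hL1
  have hL1' : Tendsto (fun n => eLpNorm ((fun ω => |W ω * M (σ n ω) ω|) -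
      fun ω => |W ω * M (τ ω) ω|) 1 P) atTop (𝓝 0) :=
    tendsto_of_tendsto_of_tendsto_of_le_of_le tendsto_const_nhds hL1 (fun _ => zero_le)
      fun n => eLpNorm_mono fun ω => by
        simpa using abs_abs_sub_abs_le (W ω * M (σ n ω) ω) (W ω * M (τ ω) ω)
  have h2 := tendsto_integral_of_L1' _ hint.abs.aestronglyMeasurable
    (Eventually.of_forall fun n => (hpull n).2.1.abs) hL1'
  refine ⟨hint, ?_, le_of_tendsto' h2 fun n => (hpull n).2.2.2⟩
  refine tendsto_nhds_unique h1 ?_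
  simp only [(hpull _).2.2.1]
  exact tendsto_const_nhds

end OptionalSampling

/-! ### Martingale part of the dark-pool expenses -/

lemma MeasureTheory.hasSum_integral_of_ae_hasSum {Ω : Type*} {mΩ : MeasurableSpace Ω}
    {P : Measure Ω} {F : ℕ → Ω → ℝ} {S : Ω → ℝ} (hF : ∀ i, Integrable (F i) P)
    (hsum : Summable fun i => ∫ ω, |F i ω| ∂P)
    (hS : ∀ᵐ ω ∂P, HasSum (fun i => F i ω) (S ω)) :
    Integrable S P ∧ HasSum (fun i => ∫ ω, F i ω ∂P) (∫ ω, S ω ∂P) := by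
  constructor
  · refine ⟨aestronglyMeasurable_of_tendsto_ae atTop
      (f := fun n ω => ∑ i ∈ Finset.range n, F i ω) (fun n => ?_)
      (hS.mono fun ω hω => hω.tendsto_sum_nat), ?_⟩
    · exact (integrable_finsetSum _ fun i _ => hF i).aestronglyMeasurable
    · have h1 : ∀ᵐ ω ∂P, ‖S ω‖ₑ ≤ ∑' i, ‖F i ω‖ₑ := by
        filter_upwards [hS] with ω hω
        refine le_of_tendsto hω.tendsto_sum_nat.enorm (Eventually.of_forall fun n => ?_)
        exact (enorm_sum_le _ _).trans (ENNReal.sum_le_tsum _)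
      refine (lintegral_mono_ae h1).trans_lt ?_
      rw [lintegral_tsum fun i => (hF i).aestronglyMeasurable.enorm]
      have h2 : ∀ i, ∫⁻ ω, ‖F i ω‖ₑ ∂P = ENNReal.ofReal (∫ ω, |F i ω| ∂P) := fun i => by
        have := ofReal_integral_norm_eq_lintegral_enorm (hF i)
        simpa using this.symm
      simp only [h2]
      exact hsum.tsum_ofReal_lt_top
  · have h := hasSum_integral_of_summable_integral_norm hF hsum
    rwa [integral_congr_ae (hS.mono fun ω hω => hω.tsum_eq)] at h

namespace DarkPoolModel

variable {Ω : Type*} [mΩ : MeasurableSpace Ω] (m : DarkPoolModel Ω)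

lemma matched_nonneg (Xhat Ξ : ℝ) (i : ℕ) (v : ℝ) (ω : Ω) : 0 ≤ m.matched Xhat Ξ i v ω := by
  unfold matched
  split_ifs
  · exact ENNReal.toReal_nonneg
  · exact le_rfl

lemma filled_le (Xhat Ξ : ℝ) (i : ℕ) (ω : Ω) : m.filled Xhat Ξ i ω ≤ |Xhat| := by
  induction i with
  | zero => exact abs_nonneg _
  | succ i ih =>
    have : m.matched Xhat Ξ i (m.filled Xhat Ξ i ω) ω ≤ |Xhat| - m.filled Xhat Ξ i ω := by
      unfold matched
      split_ifs
      · refine ENNReal.toReal_le_of_le_ofReal (sub_nonneg.2 ih) (min_le_right _ _)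
      · exact sub_nonneg.2 ih
    simp only [filled]
    linarith

lemma filled_eq_sum (Xhat Ξ : ℝ) (n : ℕ) (ω : Ω) : m.filled Xhat Ξ n ω =
    ∑ i ∈ Finset.range n, m.matched Xhat Ξ i (m.filled Xhat Ξ i ω) ω := by
  induction n with
  | zero => rfl
  | succ n ih => rw [Finset.sum_range_succ, ← ih]; rfl

lemma abs_Y_le (Xhat Ξ : ℝ) (i : ℕ) (ω : Ω) :
    |m.Y Xhat Ξ i ω| ≤ m.matched Xhat Ξ i (m.filled Xhat Ξ i ω) ω := by
  have h1 : |Real.sign Xhat| ≤ 1 := by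
    rcases Real.sign_apply_eq Xhat with h | h | h <;> simp [h]
  rw [Y, abs_mul, abs_of_nonneg (m.matched_nonneg _ _ _ _ _)]
  exact mul_le_of_le_one_left (m.matched_nonneg _ _ _ _ _) h1

lemma sum_abs_Y_le (Xhat Ξ : ℝ) (n : ℕ) (ω : Ω) :
    ∑ i ∈ Finset.range n, |m.Y Xhat Ξ i ω| ≤ |Xhat| :=
  (Finset.sum_le_sum fun i _ => m.abs_Y_le Xhat Ξ i ω).trans
    ((m.filled_eq_sum Xhat Ξ n ω).symm.trans_le (m.filled_le Xhat Ξ n ω))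

/-- The part of the `(i+1)`-st order executed before cancellation and before time `T`. -/
noncomputable def executed (χ : DarkPoolStrategy Ω) (T : ℝ≥0) (i : ℕ) : Ω → ℝ :=
  ({ω | m.τ i ω ≤ T} \ {ω | χ.ρ ω < m.τ i ω ∧ m.τ i ω ≤ T}).indicator (m.Y χ.Xhat χ.Ξ i)

variable {m} {P : Measure Ω} {χ : DarkPoolStrategy Ω}

/-- Cancellation strictly before the arrival is witnessed by some `q` from a countable dense set
with `ρ ≤ q < τ i`. On `{σ ≤ t}` this forces `q < t`, and the event `ρ ≤ q`, in the right-continuous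
`G q`, is then already in `enlarged t`. -/
lemma measurableSet_cancelled
    (hρ : IsStoppingTime (m.G χ.Xhat χ.Ξ) (fun ω => (χ.ρ ω : WithTop ℝ≥0))) (T : ℝ≥0) (i : ℕ)
    {σ : Ω → ℝ≥0} (hσ : IsStoppingTime m.enlarged (fun ω => (σ ω : WithTop ℝ≥0)))
    (hτσ : ∀ ω, min (m.τ i ω) T ≤ σ ω) :
    MeasurableSet[hσ.measurableSpace] {ω | χ.ρ ω < m.τ i ω ∧ m.τ i ω ≤ T} := by
  obtain ⟨D, hDc, hD⟩ := TopologicalSpace.exists_countable_dense ℝ≥0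
  have hτ : ∀ t, Measurable[m.enlarged t] (m.τ i) := fun t =>
    (m.measurable_τ_timesSigma i).mono (m.timesSigma_le_enlarged t) le_rfl
  have hρ' : ∀ {q t}, q < t → MeasurableSet[m.enlarged t] {ω | χ.ρ ω ≤ q} := fun {q t} hqt => by
    have := hρ q
    simp only [WithTop.coe_le_coe] at this
    exact m.G_le_enlarged hqt _ this
  have hC : ∀ {q t}, q < t →
      MeasurableSet[m.enlarged t] ({ω | χ.ρ ω ≤ q} ∩ (m.τ i ⁻¹' Ioc q T)) := fun hqt =>
    @MeasurableSet.inter _ (m.enlarged _) _ _ (hρ' hqt) (hτ _ measurableSet_Ioc)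
  rw [hσ.measurableSet]
  constructor
  · have : {ω | χ.ρ ω < m.τ i ω ∧ m.τ i ω ≤ T} =
        ⋃ q ∈ D, {ω | χ.ρ ω ≤ q} ∩ (m.τ i ⁻¹' Ioc q T) := by
      ext ω
      simp only [mem_ofPred_eq, mem_iUnion, mem_inter_iff, mem_preimage, mem_Ioc, exists_prop]
      constructor
      · rintro ⟨h1, h2⟩
        obtain ⟨q, hq, hq1, hq2⟩ := hD.exists_between h1
        exact ⟨q, hq, hq1.le, hq2, h2⟩
      · rintro ⟨q, -, h1, h2, h3⟩
        exact ⟨h1.trans_lt h2, h3⟩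
    rw [this]
    exact @MeasurableSet.biUnion _ _ (⨆ t, m.enlarged t) _ _ hDc fun q _ =>
      le_iSup (fun t => m.enlarged t) (q + 1) _ (hC (lt_add_one q))
  · intro t
    have : {ω | χ.ρ ω < m.τ i ω ∧ m.τ i ω ≤ T} ∩ {ω | (σ ω : WithTop ℝ≥0) ≤ t} =
        (⋃ q ∈ D ∩ Iio t, {ω | χ.ρ ω ≤ q} ∩ (m.τ i ⁻¹' Ioc q T)) ∩
          {ω | (σ ω : WithTop ℝ≥0) ≤ t} := by
      ext ω
      simp only [mem_ofPred_eq, mem_iUnion, mem_inter_iff, mem_preimage, mem_Ioc, exists_prop,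
        WithTop.coe_le_coe, mem_Iio, and_congr_left_iff]
      intro hσt
      constructor
      · rintro ⟨h1, h2⟩
        have h3 := hτσ ω
        rw [min_eq_left h2] at h3
        obtain ⟨q, hq, hq1, hq2⟩ := hD.exists_between h1
        exact ⟨q, ⟨hq, hq2.trans_le (h3.trans hσt)⟩, hq1.le, hq2, h2⟩
      · rintro ⟨q, -, h1, h2, h3⟩
        exact ⟨h1.trans_lt h2, h3⟩
    rw [this]
    exact @MeasurableSet.inter _ (m.enlarged t) _ _
      (@MeasurableSet.biUnion _ _ (m.enlarged t) _ _ (hDc.mono inter_subset_left)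
        fun q hq => hC hq.2) (hσ t)

lemma stronglyMeasurable_executed
    (hρ : IsStoppingTime (m.G χ.Xhat χ.Ξ) (fun ω => (χ.ρ ω : WithTop ℝ≥0))) (T : ℝ≥0) (i : ℕ)
    {σ : Ω → ℝ≥0} (hσ : IsStoppingTime m.enlarged (fun ω => (σ ω : WithTop ℝ≥0)))
    (hτσ : ∀ ω, min (m.τ i ω) T ≤ σ ω) :
    StronglyMeasurable[hσ.measurableSpace] (m.executed χ T i) := by
  have hle : m.enlarged 0 ≤ hσ.measurableSpace :=
    hσ.le_measurableSpace_of_const_le fun ω => WithTop.coe_le_coe.2 zero_le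
  have hY : Measurable[hσ.measurableSpace] (m.Y χ.Xhat χ.Ξ i) :=
    (m.measurable_Y_of (m.enlarged 0) (fun i => (m.measurable_Yt_sizesSigma i).mono
      (m.sizesSigma_le_enlarged 0) le_rfl) _ _ i).mono hle le_rfl
  have hτ : Measurable[hσ.measurableSpace] (m.τ i) :=
    (m.measurable_τ_timesSigma i).mono ((m.timesSigma_le_enlarged 0).trans hle) le_rfl
  have hset := @MeasurableSet.diff _ hσ.measurableSpace _ _ (hτ (measurableSet_Iic (a := T)))
    (measurableSet_cancelled hρ T i hσ hτσ)
  exact (hY.indicator hset).stronglyMeasurable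

lemma abs_executed_le (T : ℝ≥0) (i : ℕ) (ω : Ω) :
    |m.executed χ T i ω| ≤ |m.Y χ.Xhat χ.Ξ i ω| := by
  unfold executed
  rw [indicator_apply]
  split_ifs
  · exact le_rfl
  · simp

/-- Trades the random range of summation for a fixed one, so that expectations can be taken term by
term. Orders arriving after `ρ` contribute zero. -/
lemma hasSum_executed {T : ℝ≥0} {ω : Ω} (hρ : χ.ρ ω < T)
    (hN : ∀ t i, i < m.N t ω ↔ m.τ i ω ≤ t) (f : ℝ≥0 → ℝ) :
    HasSum (fun i => m.executed χ T i ω * f (min (m.τ i ω) T))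
      (∑ i ∈ Finset.range (m.N (χ.ρ ω) ω), m.Y χ.Xhat χ.Ξ i ω * f (m.τ i ω)) := by
  have h1 : ∀ i ∉ Finset.range (m.N (χ.ρ ω) ω),
      m.executed χ T i ω * f (min (m.τ i ω) T) = 0 := by
    intro i hi
    rw [Finset.mem_range, hN, not_le] at hi
    have : ω ∉ {ω | m.τ i ω ≤ T} \ {ω | χ.ρ ω < m.τ i ω ∧ m.τ i ω ≤ T} :=
      fun h => h.2 ⟨hi, h.1⟩
    rw [executed, indicator_of_notMem this, zero_mul]
  have h2 := hasSum_sum_of_ne_finset_zero (L := .unconditional ℕ) h1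
  rwa [Finset.sum_congr rfl fun i hi => ?_] at h2
  rw [Finset.mem_range, hN] at hi
  have hT : m.τ i ω ≤ T := hi.trans hρ.le
  have : ω ∈ {ω | m.τ i ω ≤ T} \ {ω | χ.ρ ω < m.τ i ω ∧ m.τ i ω ≤ T} :=
    ⟨hT, fun h => absurd h.1 (not_lt.2 hi)⟩
  rw [executed, indicator_of_mem this, min_eq_left hT]

variable [IsProbabilityMeasure P] {θ : ℝ≥0} {X0 : ℝ} {T : ℝ≥0}

/-- Each executed order may be priced at `P⁰_T` by `stopped_weighted`. Summing is legitimate because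
total execution is at most `|X̂|`, which bounds the `L¹` norms by `|X̂| E|P⁰_T|` in total. -/
lemma integral_dark_pool_expenses (hAC : m.IsAlmgrenChriss P) (hDP : m.HasPoissonOrders P θ)
    (hχ : m.IsAdmissible P X0 T χ) :
    Integrable (fun ω => ∑ i ∈ Finset.range (m.N (χ.ρ ω) ω),
      m.Y χ.Xhat χ.Ξ i ω * m.P0 (m.τ i ω) ω) P ∧
    Integrable (fun ω => m.Z χ.Xhat χ.Ξ (χ.ρ ω) ω * m.P0 T ω) P ∧
    ∫ ω, ∑ i ∈ Finset.range (m.N (χ.ρ ω) ω), m.Y χ.Xhat χ.Ξ i ω * m.P0 (m.τ i ω) ω ∂P =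
      ∫ ω, m.Z χ.Xhat χ.Ξ (χ.ρ ω) ω * m.P0 T ω ∂P := by
  have hM := martingale_enlarged hAC hDP
  have hPT := hM.integrable T
  have hW : ∀ i (σ : Ω → ℝ≥0)
      (hσ : IsStoppingTime m.enlarged (fun ω => (σ ω : WithTop ℝ≥0))),
      (∀ ω, min (m.τ i ω) T ≤ σ ω) →
        StronglyMeasurable[hσ.measurableSpace] (m.executed χ T i) :=
    fun i σ hσ h => stronglyMeasurable_executed hχ.ρ_stopping T i hσ h
  have hWm : ∀ i, AEStronglyMeasurable (m.executed χ T i) P := fun i =>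
    ((hW i (fun _ => T) (isStoppingTime_const _ T) (fun ω => min_le_right _ _)).mono
      (isStoppingTime_const _ T).measurableSpace_le).aestronglyMeasurable
  have hWT : ∀ i, Integrable (fun ω => m.executed χ T i ω * m.P0 T ω) P := fun i => by
    refine hPT.bdd_mul (c := |χ.Xhat|) (hWm i) (Eventually.of_forall fun ω => ?_)
    refine (abs_executed_le T i ω).trans (le_trans ?_ (m.sum_abs_Y_le χ.Xhat χ.Ξ (i + 1) ω))
    exact Finset.single_le_sum (f := fun i => |m.Y χ.Xhat χ.Ξ i ω|)
      (fun _ _ => abs_nonneg _) (Finset.self_mem_range_succ i)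
  have hsampled := fun i => hM.stopped_weighted (hAC.cadlag.mono fun ω hω t => (hω t).1)
    (((m.measurable_τ_timesSigma i).mono (m.timesSigma_le_enlarged 0) le_rfl).min
      measurable_const) (fun ω => min_le_right (m.τ i ω) T) (hW i) (hWT i)
  have hsumT : Summable fun i => ∫ ω, |m.executed χ T i ω * m.P0 T ω| ∂P := by
    refine summable_of_sum_range_le (c := ∫ ω, |χ.Xhat| * |m.P0 T ω| ∂P)
      (fun i => integral_nonneg fun ω => abs_nonneg _) fun n => ?_
    rw [← integral_finsetSum _ fun i _ => (hWT i).abs]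
    refine integral_mono (integrable_finsetSum _ fun i _ => (hWT i).abs)
      (hPT.abs.const_mul _) fun ω => ?_
    simp only [abs_mul, ← Finset.sum_mul]
    refine mul_le_mul_of_nonneg_right ?_ (abs_nonneg _)
    exact (Finset.sum_le_sum fun i _ => abs_executed_le T i ω).trans
      (m.sum_abs_Y_le χ.Xhat χ.Ξ n ω)
  have hsum : Summable fun i =>
      ∫ ω, |m.executed χ T i ω * m.P0 (min (m.τ i ω) T) ω| ∂P :=
    hsumT.of_nonneg_of_le (fun i => integral_nonneg fun ω => abs_nonneg _)
      fun i => (hsampled i).2.2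
  have hN := ae_lt_N_iff hDP.poisson (hDP.τ_increasing.mono fun _ h => h.2)
  obtain ⟨h1, h2⟩ := hasSum_integral_of_ae_hasSum (fun i => (hsampled i).1) hsum
    (S := fun ω => ∑ i ∈ Finset.range (m.N (χ.ρ ω) ω), m.Y χ.Xhat χ.Ξ i ω * m.P0 (m.τ i ω) ω)
    (by
      filter_upwards [hN, hχ.ρ_lt] with ω hω hρ
      exact hasSum_executed hρ hω fun t => m.P0 t ω)
  obtain ⟨h3, h4⟩ := hasSum_integral_of_ae_hasSum hWT hsumT
    (S := fun ω => m.Z χ.Xhat χ.Ξ (χ.ρ ω) ω * m.P0 T ω)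
    (by
      filter_upwards [hN, hχ.ρ_lt] with ω hω hρ
      rw [Z, Finset.sum_mul]
      exact hasSum_executed hρ hω fun _ => m.P0 T ω)
  refine ⟨h1, h3, h2.unique ?_⟩
  simpa only [(hsampled _).2.1] using h4

end DarkPoolModel

/-! ### Martingale part of the exchange expenses -/

/-- The section at `t > 0` of a generating rectangle `(s, ∞) × A` is `A` if `s < t` and empty
otherwise. Thus `ξ_t` needs only information strictly before `t`, which `enlarged t` contains. -/
lemma MeasureTheory.IsStronglyPredictable.stronglyMeasurable_of_lt {Ω : Type*}
    {mΩ : MeasurableSpace Ω} {G : Filtration ℝ≥0 mΩ} {u : ℝ≥0 → Ω → ℝ}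
    (hu : IsStronglyPredictable G u) {t : ℝ≥0} (ht : 0 < t) {𝒦 : MeasurableSpace Ω}
    (h : ∀ s < t, G s ≤ 𝒦) : StronglyMeasurable[𝒦] (u t) := by
  have hm : @Measurable _ _ 𝒦 G.predictable (fun ω => (t, ω)) := by
    refine @measurable_generateFrom _ _ 𝒦 _ _ ?_
    rintro _ (⟨A, -, rfl⟩ | ⟨s, A, hA, rfl⟩)
    · have : (fun ω => (t, ω)) ⁻¹' ({⊥} ×ˢ A) = ∅ := by
        ext ω
        simp [ht.ne']
      rw [this]
      exact @MeasurableSet.empty _ 𝒦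
    · by_cases hs : s < t
      · have : (fun ω => (t, ω)) ⁻¹' (Ioi s ×ˢ A) = A := by
          ext ω
          simp [hs]
        rw [this]
        exact h s hs _ hA
      · have : (fun ω => (t, ω)) ⁻¹' (Ioi s ×ˢ A) = ∅ := by
          ext ω
          simp [hs]
        rw [this]
        exact @MeasurableSet.empty _ 𝒦
  exact hu.comp_measurable hm

lemma MeasureTheory.IsStronglyPredictable.stronglyMeasurable_uncurry {Ω : Type*}
    {mΩ : MeasurableSpace Ω} {G : Filtration ℝ≥0 mΩ} {u : ℝ≥0 → Ω → ℝ}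
    (hu : IsStronglyPredictable G u) : StronglyMeasurable (Function.uncurry u) :=
  hu.mono (measurableSpace_le_predictable_of_measurableSet
    (fun _ hA => (measurableSet_singleton _).prod (G.le _ _ hA))
    (fun _ _ hA => measurableSet_Ioi.prod (G.le _ _ hA)))

lemma aestronglyMeasurable_uncurry_of_rightContinuous {Ω : Type*} {mΩ : MeasurableSpace Ω}
    {P : Measure Ω} [IsProbabilityMeasure P] {ν : Measure ℝ} [SFinite ν] {M : ℝ≥0 → Ω → ℝ}
    (hM : ∀ t, Measurable (M t))
    (hrc : ∀ᵐ ω ∂P, ∀ t, ContinuousWithinAt (fun s => M s ω) (Ici t) t) :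
    AEStronglyMeasurable (fun p : ℝ × Ω => M p.1.toNNReal p.2) (ν.prod P) := by
  refine aestronglyMeasurable_of_tendsto_ae atTop (f := fun (n : ℕ) (p : ℝ × Ω) =>
    M ((⌈p.1.toNNReal * (n + 1)⌉₊ : ℝ≥0) / (n + 1)) p.2) (fun n => ?_) ?_
  · have h1 : Measurable (fun q : ℕ × Ω => M ((q.1 : ℝ≥0) / (n + 1)) q.2) :=
      measurable_from_prod_countable_right fun k => by
        simpa using hM ((k : ℝ≥0) / (n + 1))
    have h2 : Measurable (fun p : ℝ × Ω => (⌈p.1.toNNReal * (n + 1)⌉₊, p.2)) := by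
      fun_prop
    exact (h1.comp h2).aestronglyMeasurable
  · filter_upwards [Measure.quasiMeasurePreserving_snd.ae hrc] with p hp
    exact (hp p.1.toNNReal).tendsto.comp (tendsto_ceil_mul_div p.1.toNNReal)

namespace DarkPoolModel

variable {Ω : Type*} [mΩ : MeasurableSpace Ω] {m : DarkPoolModel Ω} {P : Measure Ω}
  [IsProbabilityMeasure P] {θ : ℝ≥0} {X0 : ℝ} {T : ℝ≥0} {χ : DarkPoolStrategy Ω}

/-- For a.e. `t` the martingale property gives `E[ξ_t P⁰_t] = E[ξ_t P⁰_T]`; Fubini integrates this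
over `t`. The bound `C` makes `ξ P⁰_T` integrable on the product space, and the `L¹` contraction
transfers this to `ξ P⁰`. -/
lemma integral_exchange_expenses (hAC : m.IsAlmgrenChriss P) (hDP : m.HasPoissonOrders P θ)
    (hχ : m.IsAdmissible P X0 T χ) {C : ℝ}
    (hC : ∀ᵐ ω ∂P, ∫ t in Ioc (0 : ℝ) T, |χ.ξ t.toNNReal ω| ≤ C) :
    (∀ᵐ ω ∂P, IntegrableOn (fun t : ℝ => χ.ξ t.toNNReal ω * m.P0 t.toNNReal ω)
      (Ioc (0 : ℝ) T)) ∧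
    Integrable (fun ω => ∫ t in Ioc (0 : ℝ) T, χ.ξ t.toNNReal ω * m.P0 t.toNNReal ω) P ∧
    Integrable (fun ω => χ.traded T ω * m.P0 T ω) P ∧
    ∫ ω, (∫ t in Ioc (0 : ℝ) T, χ.ξ t.toNNReal ω * m.P0 t.toNNReal ω) ∂P =
      ∫ ω, χ.traded T ω * m.P0 T ω ∂P := by
  have hM := martingale_enlarged hAC hDP
  have hPT := hM.integrable T
  have hξm : StronglyMeasurable (fun p : ℝ × Ω => χ.ξ p.1.toNNReal p.2) :=
    hχ.ξ_predictable.stronglyMeasurable_uncurry.comp_measurable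
      (g := fun p : ℝ × Ω => (p.1.toNNReal, p.2)) (by fun_prop)
  have hP0 : ∀ t, StronglyMeasurable (m.P0 t) := fun t => (hM.1 t).mono (m.enlarged.le t)
  set ν : Measure ℝ := volume.restrict (Ioc (0 : ℝ) T) with hν
  have htr : ∀ ω, χ.traded T ω = ∫ t, χ.ξ t.toNNReal ω ∂ν := fun ω =>
    intervalIntegral.integral_of_le T.2
  have hξint : ∀ᵐ ω ∂P, Integrable (fun t : ℝ => χ.ξ t.toNNReal ω) ν :=
    hχ.ξ_integrable.mono fun ω hω => (intervalIntegrable_iff_integrableOn_Ioc_of_le T.2).1 hω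
  have hf1m : StronglyMeasurable (fun p : ℝ × Ω => χ.ξ p.1.toNNReal p.2 * m.P0 T p.2) :=
    hξm.mul ((hP0 T).comp_measurable measurable_snd)
  have hf1 : Integrable (fun p : ℝ × Ω => χ.ξ p.1.toNNReal p.2 * m.P0 T p.2) (ν.prod P) := by
    rw [integrable_prod_iff' hf1m.aestronglyMeasurable]
    refine ⟨hξint.mono fun ω hω => hω.mul_const (m.P0 T ω), ?_⟩
    refine Integrable.mono' (hPT.abs.const_mul C)
      hf1m.norm.integral_prod_left'.aestronglyMeasurable ?_
    filter_upwards [hC] with ω hω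
    rw [Real.norm_of_nonneg (integral_nonneg fun t => norm_nonneg _)]
    simp only [Real.norm_eq_abs, abs_mul, integral_mul_const]
    exact mul_le_mul_of_nonneg_right hω (abs_nonneg _)
  have hpull : ∀ᵐ t ∂ν, Integrable (fun ω => χ.ξ t.toNNReal ω * m.P0 t.toNNReal ω) P ∧
      ∫ ω, χ.ξ t.toNNReal ω * m.P0 t.toNNReal ω ∂P =
        ∫ ω, χ.ξ t.toNNReal ω * m.P0 T ω ∂P ∧
      ∫ ω, |χ.ξ t.toNNReal ω * m.P0 t.toNNReal ω| ∂P ≤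
        ∫ ω, |χ.ξ t.toNNReal ω * m.P0 T ω| ∂P := by
    filter_upwards [ae_restrict_mem measurableSet_Ioc, hf1.prod_right_ae] with t ht hft
    exact (integral_mul_condExp_eq (m.enlarged.le t.toNNReal)
      (hχ.ξ_predictable.stronglyMeasurable_of_lt (Real.toNNReal_pos.2 ht.1)
        fun s hs => m.G_le_enlarged hs) hft hPT
      (hM.2 _ _ (Real.toNNReal_le_iff_le_coe.2 ht.2)).symm).2
  have hf2m : AEStronglyMeasurable
      (fun p : ℝ × Ω => χ.ξ p.1.toNNReal p.2 * m.P0 p.1.toNNReal p.2) (ν.prod P) :=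
    hξm.aestronglyMeasurable.mul (aestronglyMeasurable_uncurry_of_rightContinuous
      (fun t => (hP0 t).measurable) (hAC.cadlag.mono fun ω hω t => (hω t).1))
  have hf2 : Integrable (fun p : ℝ × Ω => χ.ξ p.1.toNNReal p.2 * m.P0 p.1.toNNReal p.2)
      (ν.prod P) := by
    rw [integrable_prod_iff hf2m]
    refine ⟨hpull.mono fun t ht => ht.1, ?_⟩
    refine Integrable.mono' hf1.norm.integral_prod_left hf2m.norm.integral_prod_right' ?_
    filter_upwards [hpull] with t ht
    rw [Real.norm_of_nonneg (integral_nonneg fun t => norm_nonneg _)]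
    exact ht.2.2
  have htrP : ∀ ω, χ.traded T ω * m.P0 T ω = ∫ t, χ.ξ t.toNNReal ω * m.P0 T ω ∂ν := fun ω => by
    rw [htr, integral_mul_const]
  refine ⟨hf2.prod_left_ae, hf2.integral_prod_right, ?_, ?_⟩
  · simp only [htrP]
    exact hf1.integral_prod_right
  · simp only [htrP]
    rw [integral_integral_swap (f := fun ω (t : ℝ) => χ.ξ t.toNNReal ω * m.P0 t.toNNReal ω) hf2.swap,
      integral_integral_swap (f := fun ω (t : ℝ) => χ.ξ t.toNNReal ω * m.P0 T ω) hf1.swap]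
    exact integral_congr_ae (hpull.mono fun t ht => ht.2.1)

end DarkPoolModel

/-! ### Elementary inequalities and the cumulative exchange trades -/

/-- Integration by parts of the primitive against itself; it is absolutely continuous with
derivative `f` almost everywhere. -/
lemma intervalIntegral_mul_primitive {f : ℝ → ℝ} {a b : ℝ} (hf : IntervalIntegrable f volume a b) :
    ∫ x in a..b, f x * ∫ t in a..x, f t = (∫ t in a..b, f t) ^ 2 / 2 := by
  have hac := hf.absolutelyContinuousOnInterval_intervalIntegral (c := a) (by simp)
  have h := hac.integral_mul_deriv_eq_deriv_mul hac
  have hd : ∀ᵐ x, x ∈ uIoc a b → deriv (fun x => ∫ t in a..x, f t) x = f x := by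
    filter_upwards [hf.ae_hasDerivAt_integral] with x hx hxm
    exact (hx (uIoc_subset_uIcc hxm) a (by simp)).deriv
  have h1 : ∫ x in a..b, (∫ t in a..x, f t) * deriv (fun x => ∫ t in a..x, f t) x =
      ∫ x in a..b, f x * ∫ t in a..x, f t :=
    intervalIntegral.integral_congr_ae (hd.mono fun x hx hxm => by rw [hx hxm, mul_comm])
  have h2 : ∫ x in a..b, deriv (fun x => ∫ t in a..x, f t) x * (∫ t in a..x, f t) =
      ∫ x in a..b, f x * ∫ t in a..x, f t :=
    intervalIntegral.integral_congr_ae (hd.mono fun x hx hxm => by rw [hx hxm])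
  rw [h1, h2, intervalIntegral.integral_same] at h
  linarith

/-- Insert `a i ≥ -(x + ∑_{j<i} y j)` and note that `∑ y i * ∑_{j<i} y j` is half of `(∑ y i)² - ∑
(y i)²`. -/
lemma neg_le_sum_mul_of_partial_sums {n : ℕ} {x : ℝ} {y a : ℕ → ℝ} (hy : ∀ i, 0 ≤ y i)
    (ha : ∀ i < n, 0 ≤ x + a i + ∑ j ∈ Finset.range i, y j) :
    -(x * (∑ i ∈ Finset.range n, y i) + (∑ i ∈ Finset.range n, y i) ^ 2 / 2) ≤
      ∑ i ∈ Finset.range n, y i * a i := by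
  induction n with
  | zero => simp
  | succ n ih =>
    have h1 := ih fun i hi => ha i (by omega)
    have h2 := mul_nonneg (hy n) (ha n n.lt_succ_self)
    rw [Finset.sum_range_succ, Finset.sum_range_succ _ n]
    nlinarith [sq_nonneg (y n)]

/-- Progressive measurability lives on `Iic u × Ω`; clamping time at `u` turns it into measurability
of an integral over real times. -/
lemma stronglyMeasurable_setIntegral_clamp {Ω : Type*} {𝒦 : MeasurableSpace Ω} {u : ℝ≥0}
    {g : Iic u × Ω → ℝ} (hg : StronglyMeasurable g) :
    StronglyMeasurable (fun ω => ∫ t in Ioc (0 : ℝ) u,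
      g (⟨min t.toNNReal u, mem_Iic.2 (min_le_right _ _)⟩, ω)) := by
  have hm : Measurable (fun p : ℝ × Ω =>
      ((⟨min p.1.toNNReal u, mem_Iic.2 (min_le_right _ _)⟩, p.2) : Iic u × Ω)) :=
    (Measurable.subtype_mk (by fun_prop)).prodMk measurable_snd
  exact (hg.comp_measurable hm).integral_prod_left'

namespace DarkPoolStrategy

variable {Ω : Type*} {χ : DarkPoolStrategy Ω} {T : ℝ≥0} {ω : Ω}

lemma intervalIntegrable_of_le
    (hξ : IntervalIntegrable (fun s : ℝ => χ.ξ s.toNNReal ω) volume 0 T) {u v : ℝ≥0}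
    (hu : u ≤ T) (hv : v ≤ T) :
    IntervalIntegrable (fun s : ℝ => χ.ξ s.toNNReal ω) volume u v := by
  refine hξ.mono_set ?_
  rw [uIcc_of_le T.coe_nonneg]
  exact uIcc_subset_Icc ⟨u.2, hu⟩ ⟨v.2, hv⟩

lemma traded_sub_traded
    (hξ : IntervalIntegrable (fun s : ℝ => χ.ξ s.toNNReal ω) volume 0 T) {u v : ℝ≥0}
    (hu : u ≤ T) (hv : v ≤ T) :
    χ.traded v ω - χ.traded u ω = ∫ s in (u : ℝ)..v, χ.ξ s.toNNReal ω := by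
  have h0 : (0 : ℝ≥0) ≤ T := zero_le
  exact intervalIntegral.integral_interval_sub_left
    (by simpa using intervalIntegrable_of_le hξ h0 hv)
    (by simpa using intervalIntegrable_of_le hξ h0 hu)

lemma sign_mul_traded_anti
    (hξ : IntervalIntegrable (fun s : ℝ => χ.ξ s.toNNReal ω) volume 0 T) {s : ℝ}
    (hs : ∀ t ≤ T, s * χ.ξ t ω ≤ 0) {u v : ℝ≥0} (huv : u ≤ v) (hv : v ≤ T) :
    s * χ.traded v ω ≤ s * χ.traded u ω := by
  have h := traded_sub_traded hξ (huv.trans hv) hv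
  have h1 : s * ∫ r in (u : ℝ)..v, χ.ξ r.toNNReal ω ≤ 0 := by
    rw [← intervalIntegral.integral_const_mul,
      intervalIntegral.integral_of_le (NNReal.coe_le_coe.2 huv)]
    refine setIntegral_nonpos measurableSet_Ioc fun r hr => hs _ ?_
    exact (Real.toNNReal_le_iff_le_coe.2 hr.2).trans hv
  rw [← h] at h1
  linarith

lemma continuousAt_traded
    (hξ : IntervalIntegrable (fun s : ℝ => χ.ξ s.toNNReal ω) volume 0 T) {t : ℝ≥0}
    (h0 : 0 < t) (hT : t < T) : ContinuousAt (fun u => χ.traded u ω) t := by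
  have h := (intervalIntegral.continuousOn_primitive_interval' hξ left_mem_uIcc).continuousAt
    (x := (t : ℝ)) (by
      rw [uIcc_of_le T.coe_nonneg]
      exact Icc_mem_nhds (by exact_mod_cast h0) (by exact_mod_cast hT))
  exact ContinuousAt.comp (f := fun u : ℝ≥0 => (u : ℝ)) h NNReal.continuous_coe.continuousAt

lemma stronglyMeasurable_traded {mΩ : MeasurableSpace Ω} {G : Filtration ℝ≥0 mΩ}
    (h : IsStronglyPredictable G χ.ξ) (u : ℝ≥0) : StronglyMeasurable[G u] (χ.traded u) := by
  have h1 := @stronglyMeasurable_setIntegral_clamp Ω (G u) u _ (h.isStronglyProgressive u)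
  have h2 : χ.traded u = fun ω => ∫ t in Ioc (0 : ℝ) u, χ.ξ (min t.toNNReal u) ω := by
    funext ω
    rw [traded, intervalIntegral.integral_of_le u.coe_nonneg]
    refine setIntegral_congr_fun measurableSet_Ioc fun t ht => ?_
    simp only [min_eq_left (Real.toNNReal_le_iff_le_coe.2 ht.2)]
  rw [h2]
  exact h1

end DarkPoolStrategy

/-! ### The position never changes sign before a dark-pool execution -/

namespace DarkPoolModel

variable {Ω : Type*} [mΩ : MeasurableSpace Ω] {m : DarkPoolModel Ω} {P : Measure Ω}
  [IsProbabilityMeasure P] {θ : ℝ≥0} {X0 : ℝ} {T : ℝ≥0} {χ : DarkPoolStrategy Ω}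

/-- The event is known by time `v`, so it suffices to exclude it when no order arrives in `(v, T]`.
Then the position at `u` must be liquidated at the exchange alone and equals `A_u - A_T`, whose
product with `s` is nonnegative. A time `v > u` is needed because `ρ` is a stopping time of a
right-continuous filtration. -/
lemma measure_overtraded_eq_zero (hDP : m.HasPoissonOrders P θ)
    (hχ : m.IsAdmissible P X0 T χ) {s : ℝ} (hs : ∀ᵐ ω ∂P, ∀ t ≤ T, s * χ.ξ t ω ≤ 0)
    {u v : ℝ≥0} (huv : u < v) (hv : v ≤ T) (i : ℕ) :
    P {ω | u < χ.ρ ω ∧ m.N u ω = i ∧ m.N v ω = i ∧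
      s * (X0 + χ.traded u ω + ∑ j ∈ Finset.range i, m.Y χ.Xhat χ.Ξ j ω) < 0} = 0 := by
  refine hDP.measure_eq_zero_of_inter hv ?_ ?_
  · have hρ : MeasurableSet[m.arrivalsUntil v] {ω | u < χ.ρ ω} := by
      have h1 := hχ.ρ_stopping u
      simp only [WithTop.coe_le_coe] at h1
      have h2 := @MeasurableSet.compl _ _ (m.arrivalsUntil v) (m.G_le_arrivalsUntil huv _ h1)
      simpa only [compl_ofPred, not_le] using h2
    have hA : Measurable[m.arrivalsUntil v] (χ.traded u) :=
      ((DarkPoolStrategy.stronglyMeasurable_traded hχ.ξ_predictable u).mono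
        (m.G_le_arrivalsUntil huv)).measurable
    have hS : Measurable[m.arrivalsUntil v]
        (fun ω => ∑ j ∈ Finset.range i, m.Y χ.Xhat χ.Ξ j ω) :=
      @Finset.measurable_sum _ _ _ _ _ _ (m.arrivalsUntil v) _ _
        fun j _ => m.measurable_Y_arrivalsUntil v _ _ j
    have hX : Measurable[m.arrivalsUntil v] (fun ω =>
        s * (X0 + χ.traded u ω + ∑ j ∈ Finset.range i, m.Y χ.Xhat χ.Ξ j ω)) :=
      ((hA.const_add X0).add hS).const_mul s
    exact @MeasurableSet.inter _ (m.arrivalsUntil v) _ _ hρ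
      (@MeasurableSet.inter _ (m.arrivalsUntil v) _ _
        (m.measurable_N_arrivalsUntil huv.le (measurableSet_singleton i))
        (@MeasurableSet.inter _ (m.arrivalsUntil v) _ _
          (m.measurable_N_arrivalsUntil le_rfl (measurableSet_singleton i))
          (hX measurableSet_Iio)))
  · rw [measure_eq_zero_iff_ae_notMem]
    have hN := ae_lt_N_iff hDP.poisson (hDP.τ_increasing.mono fun _ h => h.2)
    filter_upwards [hs, hN, hχ.ρ_lt, hχ.ξ_integrable, hχ.liquidation]
      with ω hsω hNω hρ hξ hliq
    rintro ⟨⟨huρ, hNu, hNv, hneg⟩, hNT⟩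
    have hNρ : m.N (χ.ρ ω) ω = i := by
      refine le_antisymm (not_lt.1 fun h => ?_) (not_lt.1 fun h => ?_)
      · have h1 := (hNω T i).2 (((hNω _ _).1 h).trans hρ.le)
        rw [mem_ofPred_eq] at hNT
        omega
      · have h1 := (hNω u (m.N (χ.ρ ω) ω)).1 (by omega)
        exact absurd ((hNω _ _).2 (h1.trans huρ.le)) (lt_irrefl _)
    rw [Z, hNρ] at hliq
    have h2 := DarkPoolStrategy.sign_mul_traded_anti hξ hsω (huv.le.trans hv) le_rfl
    have h3 : X0 + χ.traded u ω + ∑ j ∈ Finset.range i, m.Y χ.Xhat χ.Ξ j ω =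
        χ.traded u ω - χ.traded T ω := by linarith
    rw [h3, mul_sub] at hneg
    linarith

/-- By continuity of `traded`, a wrong sign at `τ i` persists just to the left of `τ i`, where `N =
i` and the order is still active. Two times `u < v` from a countable dense set there contradict the
previous lemma. -/
lemma ae_not_overtraded (hDP : m.HasPoissonOrders P θ)
    (hχ : m.IsAdmissible P X0 T χ) {s : ℝ} (hs : ∀ᵐ ω ∂P, ∀ t ≤ T, s * χ.ξ t ω ≤ 0) :
    ∀ᵐ ω ∂P, ∀ i < m.N (χ.ρ ω) ω, 0 ≤ s * (X0 + χ.traded (m.τ i ω) ω +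
      ∑ j ∈ Finset.range i, m.Y χ.Xhat χ.Ξ j ω) := by
  obtain ⟨D, hDc, hD⟩ := TopologicalSpace.exists_countable_dense ℝ≥0
  have hnull : ∀ᵐ ω ∂P, ∀ u ∈ D, ∀ v ∈ D, ∀ i : ℕ, u < v → v ≤ T →
      ¬ (u < χ.ρ ω ∧ m.N u ω = i ∧ m.N v ω = i ∧
        s * (X0 + χ.traded u ω + ∑ j ∈ Finset.range i, m.Y χ.Xhat χ.Ξ j ω) < 0) := by
    refine (ae_ball_iff hDc).2 fun u _ => (ae_ball_iff hDc).2 fun v _ => ae_all_iff.2 fun i => ?_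
    by_cases huv : u < v
    · by_cases hv : v ≤ T
      · have := measure_overtraded_eq_zero hDP hχ hs huv hv i
        exact (measure_eq_zero_iff_ae_notMem.1 this).mono fun ω h _ _ => h
      · exact Eventually.of_forall fun _ _ h => absurd h hv
    · exact Eventually.of_forall fun _ h => absurd h huv
  have hN := ae_lt_N_iff hDP.poisson (hDP.τ_increasing.mono fun _ h => h.2)
  filter_upwards [hnull, hN, hDP.τ_increasing, hχ.ρ_lt, hχ.ξ_integrable]
    with ω hω hNω hτ hρ hξ i hi
  by_contra! hneg
  have hτρ : m.τ i ω ≤ χ.ρ ω := (hNω _ _).1 hi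
  have hτT : m.τ i ω < T := hτρ.trans_lt hρ
  have hτ0 : 0 < m.τ i ω := hτ.1.trans_le (hτ.2.monotone (Nat.zero_le i))
  have hc : ∀ᶠ u in 𝓝 (m.τ i ω),
      s * (X0 + χ.traded u ω + ∑ j ∈ Finset.range i, m.Y χ.Xhat χ.Ξ j ω) < 0 :=
    (((continuousAt_const.add (DarkPoolStrategy.continuousAt_traded hξ hτ0 hτT)).add
      continuousAt_const).const_mul s).eventually_lt continuousAt_const hneg
  have hprev : ∀ᶠ u in 𝓝 (m.τ i ω), ∀ j < i, m.τ j ω < u := by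
    have h := (Finset.eventually_all (Finset.range i)).2 fun j hj =>
      lt_mem_nhds (hτ.2 (Finset.mem_range.1 hj))
    exact h.mono fun u hu j hj => hu j (Finset.mem_range.2 hj)
  obtain ⟨l, hl, hsub⟩ := (mem_nhdsLT_iff_exists_Ioo_subset' hτ0).1
    (nhdsWithin_le_nhds (hc.and hprev))
  obtain ⟨u, hu, hlu, huτ⟩ := hD.exists_between hl
  obtain ⟨v, hv, huv, hvτ⟩ := hD.exists_between huτ
  have hNi : ∀ w, l < w → w < m.τ i ω → m.N w ω = i := by
    intro w hw hwτ
    refine le_antisymm (not_lt.1 fun h => ?_) (not_lt.1 fun h => ?_)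
    · exact absurd ((hNω w i).1 h) (not_le.2 hwτ)
    · exact absurd ((hNω w _).2 ((hsub ⟨hw, hwτ⟩).2 _ h).le) (lt_irrefl _)
  exact hω u hu v hv i huv (hvτ.trans hτT).le ⟨huτ.trans_le hτρ, hNi u hlu huτ,
    hNi v (hlu.trans huv) hvτ, (hsub ⟨hlu, huτ⟩).1⟩

end DarkPoolModel

/-! ### Lower bound for the costs and conclusion -/

namespace DarkPoolModel

variable {Ω : Type*} [mΩ : MeasurableSpace Ω] {m : DarkPoolModel Ω} {P : Measure Ω}
  {θ : ℝ≥0} {X0 : ℝ} {T : ℝ≥0} {χ : DarkPoolStrategy Ω}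

lemma impact_nonneg {ω : Ω} {s : ℝ} (hs1 : s * s = 1)
    (hA : ∀ t ≤ T, s * χ.traded t ω ≤ 0)
    (hτ : ∀ i < m.N (χ.ρ ω) ω, m.τ i ω ≤ T)
    (hliq : X0 + χ.traded T ω + m.Z χ.Xhat χ.Ξ (χ.ρ ω) ω = 0)
    (hover : ∀ i < m.N (χ.ρ ω) ω, 0 ≤ s * (X0 + χ.traded (m.τ i ω) ω +
      ∑ j ∈ Finset.range i, m.Y χ.Xhat χ.Ξ j ω)) :
    0 ≤ χ.traded T ω ^ 2 / 2 + ∑ i ∈ Finset.range (m.N (χ.ρ ω) ω),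
      m.Y χ.Xhat χ.Ξ i ω * χ.traded (m.τ i ω) ω := by
  have hYA : ∀ i, m.Y χ.Xhat χ.Ξ i ω * χ.traded (m.τ i ω) ω =
      (s * m.Y χ.Xhat χ.Ξ i ω) * (s * χ.traded (m.τ i ω) ω) := fun i => by
    linear_combination (-(m.Y χ.Xhat χ.Ξ i ω * χ.traded (m.τ i ω) ω)) * hs1
  have hsY : ∀ i, s * m.Y χ.Xhat χ.Ξ i ω = (s * Real.sign χ.Xhat) *
      m.matched χ.Xhat χ.Ξ i (m.filled χ.Xhat χ.Ξ i ω) ω := fun i => by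
    rw [Y, mul_assoc]
  -- First case: the dark-pool order opposes the exchange trades, and `hover` is needed. Second
  -- case: both go in the same direction and every summand is nonnegative.
  rcases le_total 0 (s * Real.sign χ.Xhat) with hsign | hsign
  · have h1 := neg_le_sum_mul_of_partial_sums (n := m.N (χ.ρ ω) ω) (x := s * X0)
      (y := fun i => s * m.Y χ.Xhat χ.Ξ i ω) (a := fun i => s * χ.traded (m.τ i ω) ω)
      (fun i => by
        rw [hsY]
        exact mul_nonneg hsign (m.matched_nonneg _ _ _ _ _))
      (fun i hi => by
        have := hover i hi
        rw [← Finset.mul_sum]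
        linarith)
    simp only [← hYA, ← Finset.mul_sum] at h1
    rw [Z] at hliq
    set S := ∑ i ∈ Finset.range (m.N (χ.ρ ω) ω), m.Y χ.Xhat χ.Ξ i ω
    have h2 : χ.traded T ω = -(X0 + S) := by linarith
    rw [h2]
    have h3 : s * X0 * (s * S) + (s * S) ^ 2 / 2 = X0 * S + S ^ 2 / 2 := by
      linear_combination (X0 * S + S ^ 2 / 2) * hs1
    rw [h3] at h1
    -- With `A_T = -(X₀ + S)`, the bound `h1` leaves at least `(X₀ + S)² / 2 - X₀ S - S² / 2 = X₀² /
    -- 2`.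
    nlinarith [sq_nonneg X0]
  · refine add_nonneg (by positivity) (Finset.sum_nonneg fun i hi => ?_)
    rw [hYA, hsY]
    exact mul_nonneg_of_nonpos_of_nonpos
      (mul_nonpos_of_nonpos_of_nonneg hsign (m.matched_nonneg _ _ _ _ _))
      (hA _ (hτ i (Finset.mem_range.1 hi)))

/-- Dropping `η ξ² ≥ 0` leaves an integrable minorant of the integrand, even when `ξ` is not square
integrable. -/
lemma le_exchangeExpenses {η : ℝ} (hη : 0 ≤ η) (hh : ∀ x, m.h x = η * x) {ω : Ω}
    (hξ : IntervalIntegrable (fun s : ℝ => χ.ξ s.toNNReal ω) volume 0 T)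
    (hξP : IntegrableOn (fun t : ℝ => χ.ξ t.toNNReal ω * m.P0 t.toNNReal ω) (Ioc (0 : ℝ) T)) :
    (((∫ t in Ioc (0 : ℝ) T, χ.ξ t.toNNReal ω * m.P0 t.toNNReal ω) +
      m.γ * (χ.traded T ω ^ 2 / 2) : ℝ) : EReal) ≤ m.exchangeExpenses T χ ω := by
  let A : ℝ → ℝ := fun t => ∫ r in (0 : ℝ)..t, χ.ξ r.toNNReal ω
  have hξA : IntervalIntegrable (fun t : ℝ => χ.ξ t.toNNReal ω * A t) volume 0 T :=
    hξ.mul_continuousOn (intervalIntegral.continuousOn_primitive_interval' hξ left_mem_uIcc)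
  have hξA' := (intervalIntegrable_iff_integrableOn_Ioc_of_le T.coe_nonneg).1 hξA
  have hint : ∫ t in Ioc (0 : ℝ) T, χ.ξ t.toNNReal ω * A t = χ.traded T ω ^ 2 / 2 := by
    rw [← intervalIntegral.integral_of_le T.coe_nonneg]
    exact intervalIntegral_mul_primitive hξ
  rw [← hint, ← integral_const_mul, ← integral_add hξP (hξA'.const_mul m.γ)]
  refine le_quasiIntegral (hξP.add (hξA'.const_mul m.γ)) ?_
  filter_upwards [ae_restrict_mem measurableSet_Ioc] with t ht
  have hAt : χ.traded t.toNNReal ω = A t := by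
    simp only [DarkPoolStrategy.traded, Real.coe_toNNReal t ht.1.le, A]
  rw [EReal.coe_le_coe_iff, exchangePrice, hh, hAt]
  nlinarith [mul_nonneg hη (mul_self_nonneg (χ.ξ t.toNNReal ω))]

variable [IsProbabilityMeasure P]

/-- The sign `s` treats pure selling (`s = 1`) and pure buying (`s = -1`) at once. The martingale
part `M` is an integrable minorant of the costs with mean zero. -/
lemma expectedCost_nonneg (hAC : m.IsAlmgrenChriss P) (hDP : m.HasPoissonOrders P θ)
    (hα : m.α = 0) (hκ : m.κ = 0) {η : ℝ} (hh : ∀ x, m.h x = η * x)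
    (hχ : m.IsAdmissible P X0 T χ) {s : ℝ} (hs1 : s * s = 1)
    (hs : ∀ᵐ ω ∂P, ∀ t ≤ T, s * χ.ξ t ω ≤ 0) : 0 ≤ m.expectedCost P X0 T χ := by
  have hη : 0 ≤ η := by
    have h := hAC.impact.strictMono (zero_lt_one (α := ℝ))
    simp only [hh] at h
    linarith
  have habs : |s| = 1 := by
    have := abs_mul_abs_self s
    nlinarith [abs_nonneg s]
  obtain ⟨C, hC⟩ := hχ.ξ_bounded
  -- For one-sided trading the total variation of the exchange trades is `|A_T|`, so the uniform
  -- bound on `traded` controls it.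
  have hvar : ∀ᵐ ω ∂P, ∫ t in Ioc (0 : ℝ) T, |χ.ξ t.toNNReal ω| ≤ C := by
    filter_upwards [hC, hs] with ω hCω hsω
    have h1 : ∫ t in Ioc (0 : ℝ) T, |χ.ξ t.toNNReal ω| =
        ∫ t in Ioc (0 : ℝ) T, -(s * χ.ξ t.toNNReal ω) := by
      refine setIntegral_congr_fun measurableSet_Ioc fun t ht => ?_
      rw [← abs_of_nonpos (hsω _ (Real.toNNReal_le_iff_le_coe.2 ht.2)), abs_mul, habs, one_mul]
    rw [h1, integral_neg, integral_const_mul, ← intervalIntegral.integral_of_le T.coe_nonneg]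
    refine (neg_le_abs _).trans ?_
    rw [abs_mul, habs, one_mul]
    exact hCω T le_rfl
  obtain ⟨hξP, hE, hAP, hEeq⟩ := integral_exchange_expenses hAC hDP hχ hvar
  obtain ⟨hD, hZP, hDeq⟩ := integral_dark_pool_expenses hAC hDP hχ
  have hP0 := (hAC.martingale.integrable 0).const_mul X0
  let M : Ω → ℝ := fun ω => X0 * m.P0 0 ω +
    (∫ t in Ioc (0 : ℝ) T, χ.ξ t.toNNReal ω * m.P0 t.toNNReal ω) +
    ∑ i ∈ Finset.range (m.N (χ.ρ ω) ω), m.Y χ.Xhat χ.Ξ i ω * m.P0 (m.τ i ω) ω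
  have hM0 : ∫ ω, M ω ∂P = 0 := by
    have h1 : ∫ ω, m.P0 0 ω ∂P = ∫ ω, m.P0 T ω ∂P := by
      have := hAC.martingale.setIntegral_eq (zero_le (a := T)) MeasurableSet.univ
      simpa using this
    have hPT := (hAC.martingale.integrable T).const_mul X0
    have h2 : ∫ ω, M ω ∂P = ∫ ω, (X0 * m.P0 T ω + χ.traded T ω * m.P0 T ω +
        m.Z χ.Xhat χ.Ξ (χ.ρ ω) ω * m.P0 T ω) ∂P := by
      refine (integral_add (hP0.add hE) hD).trans
        (Eq.trans ?_ (integral_add (hPT.add hAP) hZP).symm)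
      rw [hDeq]
      congr 1
      refine (integral_add hP0 hE).trans (Eq.trans ?_ (integral_add hPT hAP).symm)
      rw [hEeq, integral_const_mul, integral_const_mul, h1]
    rw [h2]
    refine integral_eq_zero_of_ae ?_
    filter_upwards [hχ.liquidation] with ω hω
    rw [← add_mul, ← add_mul, hω, zero_mul, Pi.zero_apply]
  rw [← EReal.coe_zero, ← hM0]
  refine le_quasiIntegral ((hP0.add hE).add hD) ?_
  have hN := ae_lt_N_iff hDP.poisson (hDP.τ_increasing.mono fun _ h => h.2)
  filter_upwards [hs, hN, hχ.ρ_lt, hχ.ξ_integrable, hχ.liquidation, hξP,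
    ae_not_overtraded hDP hχ hs] with ω hsω hNω hρ hξ hliq hξPω hover
  have hA : ∀ t ≤ T, s * χ.traded t ω ≤ 0 := fun t ht => by
    have := DarkPoolStrategy.sign_mul_traded_anti hξ hsω (zero_le (a := t)) ht
    simpa [DarkPoolStrategy.traded] using this
  have himp := impact_nonneg hs1 hA
    (fun i hi => (((hNω _ _).1 hi).trans hρ.le)) hliq hover
  have hexp := le_exchangeExpenses hη hh hξ hξPω
  unfold cost
  refine le_trans ?_ (add_le_add_left (add_le_add_right hexp _) _)
  rw [← EReal.coe_add, ← EReal.coe_add, EReal.coe_le_coe_iff]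
  have hdark : ∑ i ∈ Finset.range (m.N (χ.ρ ω) ω), m.Y χ.Xhat χ.Ξ i ω *
        (m.darkPrice χ (m.τ i ω) ω +
          m.α * m.γ * Function.leftLim (fun t => m.Z χ.Xhat χ.Ξ t ω) (m.τ i ω) +
          m.β (m.Y χ.Xhat χ.Ξ i ω)) =
      ∑ i ∈ Finset.range (m.N (χ.ρ ω) ω), m.Y χ.Xhat χ.Ξ i ω * m.P0 (m.τ i ω) ω +
      m.γ * ∑ i ∈ Finset.range (m.N (χ.ρ ω) ω),
        m.Y χ.Xhat χ.Ξ i ω * χ.traded (m.τ i ω) ω := by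
    rw [Finset.mul_sum, ← Finset.sum_add_distrib]
    refine Finset.sum_congr rfl fun i _ => ?_
    rw [darkPrice, hα, hκ, hDP.β_zero]
    ring
  rw [hdark, hα]
  simp only [M]
  nlinarith [mul_nonneg hAC.γ_pos.le himp]

end DarkPoolModel

theorem mainTheorem9 {Ω : Type*} [MeasurableSpace Ω] (P : Measure Ω) [IsProbabilityMeasure P]
    (m : DarkPoolModel Ω) (hAC : m.IsAlmgrenChriss P)
    (θ : ℝ≥0) (hθ : 0 < θ) (hDP : m.HasPoissonOrders P θ)
    (hα : m.α = 0) (hκ : m.κ = 0) (η : ℝ) (hh : ∀ x, m.h x = η * x)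
    (X0 : ℝ) (T : ℝ≥0) (hT : 0 < T)
    (χ : DarkPoolStrategy Ω) (hχ : m.IsAdmissible P X0 T χ) :
    (((0 ≤ X0 ∧ ∀ᵐ ω ∂P, ∀ t ≤ T, χ.ξ t ω ≤ 0) ∨
        (X0 ≤ 0 ∧ ∀ᵐ ω ∂P, ∀ t ≤ T, 0 ≤ χ.ξ t ω)) →
      0 ≤ m.expectedCost P X0 T χ) ∧
    (m.expectedCost P X0 T χ < 0 →
      (0 ≤ X0 → ∃ᵐ ω ∂P, ∃ t ≤ T, 0 < χ.ξ t ω) ∧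
      (X0 ≤ 0 → ∃ᵐ ω ∂P, ∃ t ≤ T, χ.ξ t ω < 0)) := by
  have hpos : ((0 ≤ X0 ∧ ∀ᵐ ω ∂P, ∀ t ≤ T, χ.ξ t ω ≤ 0) ∨
      (X0 ≤ 0 ∧ ∀ᵐ ω ∂P, ∀ t ≤ T, 0 ≤ χ.ξ t ω)) → 0 ≤ m.expectedCost P X0 T χ := by
    rintro (⟨hX0, hξ⟩ | ⟨hX0, hξ⟩)
    · refine DarkPoolModel.expectedCost_nonneg hAC hDP hα hκ hh hχ (s := 1) (by norm_num)
        (hξ.mono fun ω hω t ht => ?_)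
      simpa using hω t ht
    · refine DarkPoolModel.expectedCost_nonneg hAC hDP hα hκ hh hχ (s := -1) (by norm_num)
        (hξ.mono fun ω hω t ht => ?_)
      simpa using hω t ht
  refine ⟨hpos, fun hneg => ⟨fun hX0 => ?_, fun hX0 => ?_⟩⟩
  · by_contra h
    refine absurd (hpos (Or.inl ⟨hX0, ?_⟩)) (not_le.2 hneg)
    exact (not_frequently.1 h).mono fun ω hω t ht => not_lt.1 fun h' => hω ⟨t, ht, h'⟩
  · by_contra h
    refine absurd (hpos (Or.inr ⟨hX0, ?_⟩)) (not_le.2 hneg)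
    exact (not_frequently.1 h).mono fun ω hω t ht => not_lt.1 fun h' => hω ⟨t, ht, h'⟩
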